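/- Let $(M,g)$ be a smooth ($C^\infty$, Hausdorff, without boundary) finite-dimensional pseudo-Riemannian manifold with contravariant metric $G$ and Levi-Civita connection $\nabla$; for a function $f$, $\nabla f$ denotes its gradient. Let $T$ be a smooth symmetric contravariant tensor field of valence $2$ whose associated endomorphism field of $TM$ is at every point diagonalizable over $\mathbb{R}$ (an orthogonal tensor). Let $(\lambda_i)_{i=1}^k$ be its eigenfunctions: at each point the numbers $\lambda_1,\dots,\lambda_k$ are pairwise distinct and are exactly the eigenvalues of $T$. Let $E_i=\ker(T-\lambda_i I)$ be the corresponding eigenspaces and suppose that they are orthogonally integrable: they are distributions which are nondegenerate, $TM=\bigoplus_i E_i$ is an orthogonal direct sum, and every point of $M$ has a neighbourhood $U$ with a diffeomorphism $\prod_{i=1}^k M_i\to U$ from a product manifold that maps every slice in the direction of $M_i$ to an integral manifold of $E_i$. For a vector $x$ write $x=\sum_i x^i$ with $x^i\in E_i$. For a nondegenerate distribution $E$ of rank $m$ and sections $X,Y$ of $E$ put $s^E(X,Y)=(\nabla_XY)^{E^\perp}$ and $h^E(X,Y)=\frac12\bigl(s^E(X,Y)+s^E(Y,X)\bigr)$.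 The mean curvature normal of $E$ is $H_E=\frac1m\operatorname{tr}h^E$ (trace with respect to $g|_E$), and $E$ is umbilical if $s^E(X,Y)=g(X,Y)\,H_E$ for all sections $X,Y$ of $E$. For a smooth vector field $t$, $T$ is a conformal Killing tensor with conformal factor $t$ if $[T,G]=-2\,t\odot G$, where $\odot$ is the symmetrized product and $[\cdot,\cdot]$ is the Schouten bracket of symmetric contravariant tensors; for tensors $K,Q$ of valence $2$ it is determined by $[K,Q](df,df,df)=2K(df,d(Q(df,df)))-2Q(df,d(K(df,df)))$ for all smooth functions $f$. Then, for every smooth vector field $t$, $T$ is a conformal Killing tensor with conformal factor $t$ if and only if the following three conditions hold: 1. every eigenspace $E_i$ is umbilical; 2. for every $i$, the mean curvature normal $H_i$ of $E_i$ satisfies $$H_i=-\frac12\sum_{j\ne i}\bigl(\nabla\log|\lambda_i-\lambda_j|\bigr)^j;$$ 3. $$t=\sum_i(\nabla\lambda_i)^i .$$ -/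

import Mathlib

open scoped Manifold ContDiff Bundle

noncomputable section

namespace PseudoRiem

/-- A smooth pseudo-Riemannian metric: a smooth field of nondegenerate symmetric bilinear forms,
of arbitrary signature, on the tangent spaces of `M` (a manifold without boundary modelled on the
vector space `E`). -/
structure Metric (E M : Type*) [NormedAddCommGroup E] [NormedSpace ℝ E]
    [TopologicalSpace M] [ChartedSpace E M] [IsManifold 𝓘(ℝ, E) ∞ M] where
  val : ∀ p : M, TangentSpace 𝓘(ℝ, E) p →L[ℝ] TangentSpace 𝓘(ℝ, E) p →L[ℝ] ℝ
  symm : ∀ p v w, val p v w = val p w v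
  nondegenerate : ∀ p v, (∀ w, val p v w = 0) → v = 0
  contMDiff : ContMDiff 𝓘(ℝ, E) (𝓘(ℝ, E).prod 𝓘(ℝ, E →L[ℝ] E →L[ℝ] ℝ)) ∞
    (fun p => Bundle.TotalSpace.mk' (E →L[ℝ] E →L[ℝ] ℝ) p (val p))

/-- A smooth symmetric contravariant tensor field of valence 2: a field of symmetric bilinear
forms on the cotangent spaces of `M` which is smooth, that is, its value on two one-forms is
smooth wherever the one-forms are. -/
structure SymTensor (E M : Type*) [NormedAddCommGroup E] [NormedSpace ℝ E]
    [TopologicalSpace M] [ChartedSpace E M] [IsManifold 𝓘(ℝ, E) ∞ M] where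
  val : ∀ p : M, LinearMap.BilinForm ℝ (TangentSpace 𝓘(ℝ, E) p →L[ℝ] ℝ)
  symm : ∀ p α β, val p α β = val p β α
  contMDiffAt : ∀ (p : M) (α β : ∀ q : M, TangentSpace 𝓘(ℝ, E) q →L[ℝ] ℝ),
    ContMDiffAt 𝓘(ℝ, E) (𝓘(ℝ, E).prod 𝓘(ℝ, E →L[ℝ] ℝ)) ∞
      (fun q => Bundle.TotalSpace.mk' (E →L[ℝ] ℝ) q (α q)) p →
    ContMDiffAt 𝓘(ℝ, E) (𝓘(ℝ, E).prod 𝓘(ℝ, E →L[ℝ] ℝ)) ∞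
      (fun q => Bundle.TotalSpace.mk' (E →L[ℝ] ℝ) q (β q)) p →
    ContMDiffAt 𝓘(ℝ, E) 𝓘(ℝ, ℝ) ∞ (fun q => val q (α q) (β q)) p

section

variable {E M : Type*} [NormedAddCommGroup E] [NormedSpace ℝ E]
  [TopologicalSpace M] [ChartedSpace E M]

/-- `X` is a smooth vector field on `M`. -/
def IsSmoothField [IsManifold 𝓘(ℝ, E) ∞ M] (X : ∀ p : M, TangentSpace 𝓘(ℝ, E) p) : Prop :=
  ContMDiff 𝓘(ℝ, E) (𝓘(ℝ, E).prod 𝓘(ℝ, E)) ∞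
    (fun p => (Bundle.TotalSpace.mk' E p (X p) : TangentBundle 𝓘(ℝ, E) M))

/-- The differential of a real function at a point. -/
abbrev diff (f : M → ℝ) (p : M) : TangentSpace 𝓘(ℝ, E) p →L[ℝ] ℝ :=
  mvfderiv 𝓘(ℝ, E) f p

end

section

variable {E M : Type*} [NormedAddCommGroup E] [NormedSpace ℝ E] [FiniteDimensional ℝ E]
  [TopologicalSpace M] [ChartedSpace E M] [IsManifold 𝓘(ℝ, E) ∞ M]

instance (p : M) : FiniteDimensional ℝ (TangentSpace 𝓘(ℝ, E) p) :=
  inferInstanceAs (FiniteDimensional ℝ E)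

/-- The lowering of indices `v ↦ g(v, ·)` as an isomorphism onto the cotangent space. -/
def Metric.flat (g : Metric E M) (p : M) :
    TangentSpace 𝓘(ℝ, E) p ≃ₗ[ℝ] Module.Dual ℝ (TangentSpace 𝓘(ℝ, E) p) :=
  LinearEquiv.ofInjectiveOfFinrankEq
    ((ContinuousLinearMap.coeLM ℝ).comp (g.val p).toLinearMap)
    (by
      rw [injective_iff_map_eq_zero]
      intro v hv
      exact g.nondegenerate p v fun w => LinearMap.congr_fun hv w)
    (Subspace.dual_finrank_eq).symm

/-- The raising of indices: `g (sharp α) v = α v`. -/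
def Metric.sharp (g : Metric E M) (p : M) :
    Module.Dual ℝ (TangentSpace 𝓘(ℝ, E) p) ≃ₗ[ℝ] TangentSpace 𝓘(ℝ, E) p :=
  (g.flat p).symm

theorem Metric.val_sharp (g : Metric E M) (p : M)
    (α : Module.Dual ℝ (TangentSpace 𝓘(ℝ, E) p)) (v : TangentSpace 𝓘(ℝ, E) p) :
    g.val p (g.sharp p α) v = α v :=
  LinearMap.congr_fun ((g.flat p).apply_symm_apply α) v

/-- The gradient of a function. -/
def Metric.grad (g : Metric E M) (f : M → ℝ) (p : M) : TangentSpace 𝓘(ℝ, E) p :=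
  g.sharp p (diff f p).toLinearMap

/-- The contravariant metric `G`, as a bilinear form on covectors. -/
def Metric.contra (g : Metric E M) (p : M) (α β : TangentSpace 𝓘(ℝ, E) p →L[ℝ] ℝ) : ℝ :=
  α (g.sharp p β.toLinearMap)

/-! ### Levi-Civita connection -/

/-- The right-hand side of the Koszul formula for `2 g(∇_X Y, Z)`. -/
def Metric.koszul (g : Metric E M) (X Y Z : ∀ p : M, TangentSpace 𝓘(ℝ, E) p) (p : M) : ℝ :=
  diff (fun q => g.val q (Y q) (Z q)) p (X p)
    + diff (fun q => g.val q (X q) (Z q)) p (Y p)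
    - diff (fun q => g.val q (X q) (Y q)) p (Z p)
    + g.val p (VectorField.mlieBracket 𝓘(ℝ, E) X Y p) (Z p)
    - g.val p (VectorField.mlieBracket 𝓘(ℝ, E) X Z p) (Y p)
    - g.val p (VectorField.mlieBracket 𝓘(ℝ, E) Y Z p) (X p)

/-- The Levi-Civita covariant derivative `∇_X Y`: the vector field with
`2 g(∇_X Y, Z) = koszul X Y Z`. At a point `p` it is enough to impose this for `Z` running
through local extensions of a basis of the tangent space, since the right-hand side depends on
`Z` only through its value at `p` when `X` and `Y` are differentiable. -/
def Metric.leviCivita (g : Metric E M) (X Y : ∀ p : M, TangentSpace 𝓘(ℝ, E) p) (p : M) :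
    TangentSpace 𝓘(ℝ, E) p :=
  g.sharp p ((Module.finBasis ℝ (TangentSpace 𝓘(ℝ, E) p)).constr ℝ fun a =>
    (1 / 2 : ℝ) * g.koszul X Y
      (FiberBundle.extend E (Module.finBasis ℝ (TangentSpace 𝓘(ℝ, E) p) a)) p)

/-! ### Orthogonal splittings and the geometry of a distribution -/

/-- The orthogonal complement of a subspace of a tangent space. -/
def Metric.perp (g : Metric E M) (p : M) (S : Submodule ℝ (TangentSpace 𝓘(ℝ, E) p)) :
    Submodule ℝ (TangentSpace 𝓘(ℝ, E) p) where
  carrier := {v | ∀ w ∈ S, g.val p v w = 0}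
  add_mem' := by
    intro a b ha hb w hw
    simp [ha w hw, hb w hw]
  zero_mem' := by simp
  smul_mem' := by
    intro c a ha w hw
    simp [ha w hw]

open Classical in
/-- The orthogonal projection of a tangent space onto a subspace `S` on which the metric is
nondegenerate (equivalently, which is complementary to its orthogonal complement);
by convention `0` for degenerate `S`. -/
def Metric.proj (g : Metric E M) (p : M) (S : Submodule ℝ (TangentSpace 𝓘(ℝ, E) p)) :
    TangentSpace 𝓘(ℝ, E) p →ₗ[ℝ] TangentSpace 𝓘(ℝ, E) p :=
  if h : IsCompl S (g.perp p S) then S.projection (g.perp p S) h else 0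

/-- The second fundamental form `s(X, Y) = (∇_X Y)^⊥` of a distribution `D`, for sections
`X`, `Y` of `D`, with values in the orthogonal complement of `D`. -/
def Metric.sff (g : Metric E M) (D : ∀ p : M, Submodule ℝ (TangentSpace 𝓘(ℝ, E) p))
    (X Y : ∀ p : M, TangentSpace 𝓘(ℝ, E) p) (p : M) : TangentSpace 𝓘(ℝ, E) p :=
  g.leviCivita X Y p - g.proj p (D p) (g.leviCivita X Y p)

/-- A section of the distribution `D` defined near `p` and with value `x` at `p`, when
`x ∈ D p`. -/
def Metric.extendIn (g : Metric E M) (D : ∀ p : M, Submodule ℝ (TangentSpace 𝓘(ℝ, E) p))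
    (p : M) (x : TangentSpace 𝓘(ℝ, E) p) (q : M) : TangentSpace 𝓘(ℝ, E) q :=
  g.proj q (D q) (FiberBundle.extend E x q)

/-- The symmetric part `h(x, y) = (s(x, y) + s(y, x)) / 2` of the second fundamental form, as a
tensor: it is evaluated on vectors `x`, `y` of `D p` by extending them to sections of `D`. -/
def Metric.symmSff (g : Metric E M) (D : ∀ p : M, Submodule ℝ (TangentSpace 𝓘(ℝ, E) p))
    (p : M) (x y : TangentSpace 𝓘(ℝ, E) p) : TangentSpace 𝓘(ℝ, E) p :=
  (1 / 2 : ℝ) • (g.sff D (g.extendIn D p x) (g.extendIn D p y) p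
    + g.sff D (g.extendIn D p y) (g.extendIn D p x) p)

/-- The matrix of the metric restricted to `D p` in a basis of `D p`. -/
def Metric.gram (g : Metric E M) (D : ∀ p : M, Submodule ℝ (TangentSpace 𝓘(ℝ, E) p)) (p : M) :
    Matrix (Fin (Module.finrank ℝ (D p))) (Fin (Module.finrank ℝ (D p))) ℝ :=
  Matrix.of fun a b => g.val p (Module.finBasis ℝ (D p) a) (Module.finBasis ℝ (D p) b)

/-- The mean curvature normal `H = (1/m) tr h` of a distribution `D` of rank `m`. -/
def Metric.meanCurvatureNormal (g : Metric E M)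
    (D : ∀ p : M, Submodule ℝ (TangentSpace 𝓘(ℝ, E) p)) (p : M) : TangentSpace 𝓘(ℝ, E) p :=
  (Module.finrank ℝ (D p) : ℝ)⁻¹ •
    ∑ a, ∑ b, (g.gram D p)⁻¹ a b •
      g.symmSff D p (Module.finBasis ℝ (D p) a) (Module.finBasis ℝ (D p) b)

/-- `D` is umbilical: `s(X, Y) = g(X, Y) H` for all smooth sections `X`, `Y` of `D`, where `H`
is the mean curvature normal of `D`. -/
def Metric.IsUmbilical (g : Metric E M)
    (D : ∀ p : M, Submodule ℝ (TangentSpace 𝓘(ℝ, E) p)) : Prop :=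
  ∀ X Y : ∀ p : M, TangentSpace 𝓘(ℝ, E) p, IsSmoothField X → IsSmoothField Y →
    (∀ p, X p ∈ D p) → (∀ p, Y p ∈ D p) →
    ∀ p, g.sff D X Y p = g.val p (X p) (Y p) • g.meanCurvatureNormal D p

/-! ### Integrable nets -/

/-- A family of distributions is an integrable net if it splits the tangent bundle into an
orthogonal direct sum of nondegenerate subspaces and `M` is locally diffeomorphic to a product in
such a way that the slices are integral manifolds of the distributions. As this is local, the
factors of the product are taken to be open subsets `U i` of Euclidean spaces of dimension `m i`;
`φ` is the diffeomorphism from their product onto a neighbourhood of the given point. -/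
structure Metric.IsIntegrableNet (g : Metric E M) {ι : Type*} [Fintype ι] [DecidableEq ι]
    (D : ι → ∀ p : M, Submodule ℝ (TangentSpace 𝓘(ℝ, E) p)) : Prop where
  nondegenerate : ∀ i p, ∀ v ∈ D i p, (∀ w ∈ D i p, g.val p v w = 0) → v = 0
  orthogonal : ∀ i j, i ≠ j → ∀ p, ∀ v ∈ D i p, ∀ w ∈ D j p, g.val p v w = 0
  directSum : ∀ p, DirectSum.IsInternal fun i => D i p
  adapted : ∀ p : M, ∃ (m : ι → ℕ) (U : ∀ i, Set (EuclideanSpace ℝ (Fin (m i))))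
    (φ : OpenPartialHomeomorph (∀ i, EuclideanSpace ℝ (Fin (m i))) M),
    (∀ i, IsOpen (U i)) ∧ φ.source = Set.pi Set.univ U ∧ p ∈ φ.target ∧
    ContMDiffOn 𝓘(ℝ, ∀ i, EuclideanSpace ℝ (Fin (m i))) 𝓘(ℝ, E) ∞ φ φ.source ∧
    ContMDiffOn 𝓘(ℝ, E) 𝓘(ℝ, ∀ i, EuclideanSpace ℝ (Fin (m i))) ∞ φ.symm φ.target ∧
    ∀ q ∈ φ.source, ∀ i, (D i (φ q) : Set (TangentSpace 𝓘(ℝ, E) (φ q))) =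
      Set.range fun v : EuclideanSpace ℝ (Fin (m i)) =>
        mfderiv 𝓘(ℝ, ∀ i, EuclideanSpace ℝ (Fin (m i))) 𝓘(ℝ, E) φ q (Pi.single i v)

/-! ### Orthogonal tensors -/

/-- The endomorphism of the tangent space associated with `T`, characterised by
`g(endo v, u) = T(g(u, ·), g(v, ·))`. -/
def SymTensor.endo (T : SymTensor E M) (g : Metric E M) (p : M) :
    TangentSpace 𝓘(ℝ, E) p →ₗ[ℝ] TangentSpace 𝓘(ℝ, E) p where
  toFun v := g.sharp p ((T.val p (g.val p v)).comp (g.val p).toLinearMap)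
  map_add' v w := by
    rw [← map_add]
    congr 1
    ext u
    simp
  map_smul' c v := by
    rw [RingHom.id_apply, ← map_smul]
    congr 1
    ext u
    simp

/-- `T` is an orthogonal tensor: its endomorphism is pointwise diagonalizable over `ℝ`. -/
def SymTensor.IsOrthogonal (T : SymTensor E M) (g : Metric E M) : Prop :=
  ∀ p, ⨆ μ : ℝ, Module.End.eigenspace (T.endo g p) μ = ⊤

/-- `(l i)` is the family of eigenfunctions of `T`: at each point the `l i p` are pairwise
distinct and are all the eigenvalues of the endomorphism of `T`. -/
structure SymTensor.IsEigenfunctions (T : SymTensor E M) (g : Metric E M) {ι : Type*}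
    (l : ι → M → ℝ) : Prop where
  distinct : ∀ p, Function.Injective fun i => l i p
  hasEigenvalue_iff : ∀ p μ, Module.End.HasEigenvalue (T.endo g p) μ ↔ ∃ i, l i p = μ

/-- The eigenspaces `ker (T - f)` of an eigenfunction `f`, as a distribution. -/
def SymTensor.eigendist (T : SymTensor E M) (g : Metric E M) (f : M → ℝ) (p : M) :
    Submodule ℝ (TangentSpace 𝓘(ℝ, E) p) :=
  Module.End.eigenspace (T.endo g p) (f p)

/-! ### Conformal Killing tensors -/

/-- The Schouten bracket `[K, Q]` of symmetric contravariant fields of valence 2, evaluated on the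
differentials of three functions. It is the polarization of
`[K, Q](df, df, df) = 2 K(df, d(Q(df, df))) - 2 Q(df, d(K(df, df)))`, so that in coordinates it is
the symmetrization over `i, j, k` of `2 K^{li} ∂_l Q^{jk} - 2 Q^{li} ∂_l K^{jk}`; it corresponds
to the Poisson bracket of the associated fibrewise quadratic functions on the cotangent bundle. -/
def schouten (K Q : ∀ p : M, (TangentSpace 𝓘(ℝ, E) p →L[ℝ] ℝ) →
      (TangentSpace 𝓘(ℝ, E) p →L[ℝ] ℝ) → ℝ) (f₁ f₂ f₃ : M → ℝ) (p : M) : ℝ :=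
  let term (a b c : M → ℝ) : ℝ :=
    2 * K p (diff a p) (diff (fun q => Q q (diff b q) (diff c q)) p)
      - 2 * Q p (diff a p) (diff (fun q => K q (diff b q) (diff c q)) p)
  (1 / 3 : ℝ) * (term f₁ f₂ f₃ + term f₂ f₃ f₁ + term f₃ f₁ f₂)

/-- The symmetric product `t ⊙ G` of a vector and a symmetric bilinear form on covectors. -/
def symProd {p : M} (t : TangentSpace 𝓘(ℝ, E) p)
    (G : (TangentSpace 𝓘(ℝ, E) p →L[ℝ] ℝ) → (TangentSpace 𝓘(ℝ, E) p →L[ℝ] ℝ) → ℝ)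
    (α β γ : TangentSpace 𝓘(ℝ, E) p →L[ℝ] ℝ) : ℝ :=
  (1 / 3 : ℝ) * (α t * G β γ + β t * G γ α + γ t * G α β)

/-- `T` is a conformal Killing tensor with conformal factor `t`: `[T, G] = -2 t ⊙ G`. Every
covector is the differential of a smooth function, so it is enough to test the equality of these
symmetric tensors of valence 3 on differentials. -/
def SymTensor.IsConformalKilling (T : SymTensor E M) (g : Metric E M)
    (t : ∀ p : M, TangentSpace 𝓘(ℝ, E) p) : Prop :=
  ∀ f₁ f₂ f₃ : M → ℝ, ContMDiff 𝓘(ℝ, E) 𝓘(ℝ, ℝ) ∞ f₁ → ContMDiff 𝓘(ℝ, E) 𝓘(ℝ, ℝ) ∞ f₂ →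
    ContMDiff 𝓘(ℝ, E) 𝓘(ℝ, ℝ) ∞ f₃ → ∀ p : M,
    schouten (fun q α β => T.val q α β) g.contra f₁ f₂ f₃ p
      = -2 * symProd (t p) (g.contra p) (diff f₁ p) (diff f₂ p) (diff f₃ p)

end

end PseudoRiem

end

/-! The statement is pointwise and local, so it is proved in a parametrization `φ` by a product in
which the eigenspaces `E_i` become the ranges of constant complementary projections `P i`. There the
metric `ĝ = g.hat φ` is block diagonal, and since the `P i` are constant, so is each of its
directional derivatives. Both sides of the equivalence become statements about the first derivatives
of `ĝ` and of the eigenfunctions.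

On the geometric side, the Koszul formula for sections `X`, `Y` of `E_i`, tested on a vector `v`
normal to `E_i`, collapses to `g(s(X, Y), v) = -(1/2) (∂_v ĝ)(X, Y)` (`Metric.IsAdapted.val_sff`).
Umbilicity with the prescribed normal therefore says that the derivative of the `j`-th block of `ĝ`
in a direction `x` of `E_i`, `i ≠ j`, is that block times `d log|λ_i - λ_j|(x)`. With the
denominator cleared this is `NormalDerivEq` (`Metric.IsAdapted.normalDerivEq_iff`).

On the tensor side, covectors are written as differentials and replaced by gradients. The Hessians
cancel in the symmetrized bracket, and what remains is the symmetrization of the cubic form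
`bracketForm` (`Metric.IsAdapted.schouten_eq`). Every vector is a gradient at a given point, so the
conformal Killing equation becomes the algebraic identity `KillingEq`. Its `(i, i, i)` components
say that `dλ_i = g(t, ·)` on `E_i`, which is the formula for `t`; its `(i, j, j)` components are
then `NormalDerivEq`; components with three distinct indices vanish by block diagonality
(`Metric.IsAdapted.killingEq_iff`). -/

set_option linter.unusedSectionVars false

open scoped Manifold ContDiff Bundle

noncomputable section

namespace PseudoRiem

/-! ### Vector fields, brackets and differentials in a local parametrization. -/

section

variable {E M V : Type*} [NormedAddCommGroup E] [NormedSpace ℝ E] [FiniteDimensional ℝ E]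
  [TopologicalSpace M] [ChartedSpace E M] [IsManifold 𝓘(ℝ, E) ∞ M]
  [NormedAddCommGroup V] [NormedSpace ℝ V] [FiniteDimensional ℝ V]

/-- A local parametrization of `M` by an open subset of the vector space `V`. -/
structure IsParam (φ : OpenPartialHomeomorph V M) : Prop where
  smooth : ContMDiffOn 𝓘(ℝ, V) 𝓘(ℝ, E) ∞ φ φ.source
  smooth_symm : ContMDiffOn 𝓘(ℝ, E) 𝓘(ℝ, V) ∞ φ.symm φ.target

/-- The derivative of a parametrization, as a map defined on the vector space `V`. -/
def push (φ : OpenPartialHomeomorph V M) (u : V) : V →L[ℝ] TangentSpace 𝓘(ℝ, E) (φ u) :=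
  (mfderiv 𝓘(ℝ, V) 𝓘(ℝ, E) φ u).comp
    (NormedSpace.fromTangentSpace (𝕜 := ℝ) u).symm.toContinuousLinearMap

/-- The expression of a vector field in a parametrization. -/
def pull (φ : OpenPartialHomeomorph V M) (X : ∀ p : M, TangentSpace 𝓘(ℝ, E) p) (u : V) : V :=
  (push φ u).inverse (X (φ u))

variable {φ : OpenPartialHomeomorph V M} {u : V}

theorem IsParam.mdifferentiable (hφ : IsParam (E := E) φ) :
    φ.MDifferentiable 𝓘(ℝ, V) 𝓘(ℝ, E) :=
  ⟨hφ.smooth.mdifferentiableOn (by simp), hφ.smooth_symm.mdifferentiableOn (by simp)⟩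

theorem IsParam.contMDiffAt (hφ : IsParam (E := E) φ) (hu : u ∈ φ.source) :
    ContMDiffAt 𝓘(ℝ, V) 𝓘(ℝ, E) ∞ φ u :=
  hφ.smooth.contMDiffAt (φ.open_source.mem_nhds hu)

theorem IsParam.contMDiffAt_symm (hφ : IsParam (E := E) φ) {p : M} (hp : p ∈ φ.target) :
    ContMDiffAt 𝓘(ℝ, E) 𝓘(ℝ, V) ∞ φ.symm p :=
  hφ.smooth_symm.contMDiffAt (φ.open_target.mem_nhds hp)

theorem IsParam.isInvertible_mfderiv (hφ : IsParam (E := E) φ) (hu : u ∈ φ.source) :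
    (mfderiv 𝓘(ℝ, V) 𝓘(ℝ, E) φ u).IsInvertible :=
  ⟨hφ.mdifferentiable.mfderiv hu, rfl⟩

theorem IsParam.isInvertible_push (hφ : IsParam (E := E) φ) (hu : u ∈ φ.source) :
    (push (E := E) φ u).IsInvertible :=
  (hφ.isInvertible_mfderiv hu).comp ContinuousLinearMap.isInvertible_equiv

theorem IsParam.push_pull (hφ : IsParam (E := E) φ) (hu : u ∈ φ.source)
    (X : ∀ p : M, TangentSpace 𝓘(ℝ, E) p) : push φ u (pull φ X u) = X (φ u) :=
  (hφ.isInvertible_push hu).self_apply_inverse _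

theorem IsParam.push_injective (hφ : IsParam (E := E) φ) (hu : u ∈ φ.source) :
    Function.Injective (push (E := E) φ u) :=
  (hφ.isInvertible_push hu).injective

theorem IsParam.push_surjective (hφ : IsParam (E := E) φ) (hu : u ∈ φ.source) :
    Function.Surjective (push (E := E) φ u) :=
  (hφ.isInvertible_push hu).surjective

theorem pull_eq_of_push_eq (hφ : IsParam (E := E) φ) (hu : u ∈ φ.source)
    {X : ∀ p : M, TangentSpace 𝓘(ℝ, E) p} {v : V} (h : push φ u v = X (φ u)) :
    pull φ X u = v :=
  hφ.push_injective hu ((hφ.push_pull hu X).trans h.symm)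

/-- The tangent spaces of `V` are definitionally `V`; this makes smoothness and bracket naturality
of `mpullback` available for `pull`. -/
theorem pull_eq_mpullback (φ : OpenPartialHomeomorph V M) (X : ∀ p : M, TangentSpace 𝓘(ℝ, E) p) :
    pull φ X = VectorField.mpullback 𝓘(ℝ, V) 𝓘(ℝ, E) φ X := by
  funext u
  rfl

/-- A vector field is smooth at a point. -/
abbrev SmoothFieldAt (X : ∀ p : M, TangentSpace 𝓘(ℝ, E) p) (p : M) : Prop :=
  ContMDiffAt 𝓘(ℝ, E) (𝓘(ℝ, E).prod 𝓘(ℝ, E)) ∞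
    (fun p => (Bundle.TotalSpace.mk' E p (X p) : TangentBundle 𝓘(ℝ, E) M)) p

theorem IsParam.contDiffAt_pull (hφ : IsParam (E := E) φ) (hu : u ∈ φ.source)
    {X : ∀ p : M, TangentSpace 𝓘(ℝ, E) p} (hX : SmoothFieldAt X (φ u)) :
    ContDiffAt ℝ ∞ (pull φ X) u := by
  have : IsManifold 𝓘(ℝ, E) 1 M := IsManifold.of_le (n := ∞) (by simp)
  have := FiniteDimensional.complete ℝ V
  have h := ContMDiffAt.mpullback_vectorField_preimage (n := ∞) (m := ∞) hX (hφ.contMDiffAt hu)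
    (hφ.isInvertible_mfderiv hu) (by simp)
  exact contMDiffAt_vectorSpace_iff_contDiffAt.1 h

theorem IsParam.pull_mlieBracket (hφ : IsParam (E := E) φ) (hu : u ∈ φ.source)
    {X Y : ∀ p : M, TangentSpace 𝓘(ℝ, E) p} (hX : SmoothFieldAt X (φ u))
    (hY : SmoothFieldAt Y (φ u)) :
    pull φ (VectorField.mlieBracket 𝓘(ℝ, E) X Y) u =
      fderiv ℝ (pull φ Y) u (pull φ X u) - fderiv ℝ (pull φ X) u (pull φ Y u) := by
  have := FiniteDimensional.complete ℝ V
  have := FiniteDimensional.complete ℝ E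
  have : IsManifold 𝓘(ℝ, E) (minSmoothness ℝ 3) M := by
    rw [minSmoothness_of_isRCLikeNormedField]
    exact IsManifold.of_le (n := ∞) (WithTop.coe_le_coe.2 (le_top : (3 : ℕ∞) ≤ ⊤))
  have h := VectorField.mpullback_mlieBracket (hX.mdifferentiableAt (by simp))
    (hY.mdifferentiableAt (by simp)) (hφ.contMDiffAt hu)
    (by
      rw [minSmoothness_of_isRCLikeNormedField]
      exact WithTop.coe_le_coe.2 (le_top : (2 : ℕ∞) ≤ ⊤))
  rw [← VectorField.mlieBracketWithin_univ (I := 𝓘(ℝ, V)),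
    VectorField.mlieBracketWithin_eq_lieBracketWithin] at h
  rw [pull_eq_mpullback, h]
  exact congrFun (VectorField.lieBracketWithin_univ (V := pull φ X) (W := pull φ Y)) u

/-- Chain rule. Differentiability is needed only for the local expression, because near `φ u` the
function `f` is that expression composed with `φ.symm`. This matters for eigenfunctions, whose
regularity is obtained only in the parametrization. -/
theorem IsParam.diff_push (hφ : IsParam (E := E) φ) (hu : u ∈ φ.source) {f : M → ℝ}
    (hf : DifferentiableAt ℝ (fun w => f (φ w)) u) (v : V) :
    diff f (φ u) (push (E := E) φ u v) = fderiv ℝ (fun w => f (φ w)) u v := by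
  have hf' : MDifferentiableAt 𝓘(ℝ, E) 𝓘(ℝ, ℝ) f (φ u) := by
    have h1 : MDifferentiableAt 𝓘(ℝ, V) 𝓘(ℝ, ℝ) (fun w => f (φ w)) (φ.symm (φ u)) := by
      rw [φ.left_inv hu]; exact hf.mdifferentiableAt
    refine (h1.comp (φ u) ((hφ.contMDiffAt_symm (φ.map_source hu)).mdifferentiableAt
      (by simp))).congr_of_eventuallyEq ?_
    filter_upwards [φ.open_target.mem_nhds (φ.map_source hu)] with q hq
    simp [φ.right_inv hq]
  have h := mvfderiv_comp_apply u hf' ((hφ.contMDiffAt hu).mdifferentiableAt (by simp))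
    ((NormedSpace.fromTangentSpace (𝕜 := ℝ) u).symm v)
  refine h.symm.trans ?_
  simp only [mvfderiv, mfderiv_eq_fderiv]
  rfl

/-- The vector field on the range of a parametrization with a given local expression. -/
def pushField (φ : OpenPartialHomeomorph V M) (F : V → V) (q : M) : TangentSpace 𝓘(ℝ, E) q :=
  VectorField.mpullback 𝓘(ℝ, E) 𝓘(ℝ, V) φ.symm F q

theorem IsParam.pushField_apply (hφ : IsParam (E := E) φ) (hu : u ∈ φ.source) (F : V → V) :
    pushField (E := E) φ F (φ u) = push φ u (F u) := by
  have h2 : (mfderiv 𝓘(ℝ, E) 𝓘(ℝ, V) φ.symm (φ u)).IsInvertible :=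
    ⟨hφ.mdifferentiable.symm.mfderiv (φ.map_source hu), rfl⟩
  have h3 := hφ.mdifferentiable.symm_comp_deriv hu
  apply h2.injective
  refine (h2.self_apply_inverse _).trans ?_
  have h4 := DFunLike.congr_fun h3 ((NormedSpace.fromTangentSpace (𝕜 := ℝ) u).symm (F u))
  refine Eq.trans ?_ h4.symm
  exact congrArg F (φ.left_inv hu)

theorem IsParam.smoothFieldAt_pushField (hφ : IsParam (E := E) φ) (hu : u ∈ φ.source) {F : V → V}
    (hF : ContDiffAt ℝ ∞ F u) :
    SmoothFieldAt (pushField (E := E) φ F) (φ u) := by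
  have := FiniteDimensional.complete ℝ V
  have := FiniteDimensional.complete ℝ E
  have : IsManifold 𝓘(ℝ, E) 1 M := IsManifold.of_le (n := ∞) (by simp)
  have h2 : (mfderiv 𝓘(ℝ, E) 𝓘(ℝ, V) φ.symm (φ u)).IsInvertible :=
    ⟨hφ.mdifferentiable.symm.mfderiv (φ.map_source hu), rfl⟩
  refine ContMDiffAt.mpullback_vectorField_preimage (n := ∞) (I := 𝓘(ℝ, E)) (I' := 𝓘(ℝ, V))
    (V := F) ?_ (hφ.contMDiffAt_symm (φ.map_source hu)) h2 (by simp)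
  rw [φ.left_inv hu]
  exact contMDiffAt_vectorSpace_iff_contDiffAt.2 hF

/-! ### The metric and the Levi-Civita connection in a parametrization. -/

/-- The expression of a metric in a parametrization. -/
def Metric.hat (g : Metric E M) (φ : OpenPartialHomeomorph V M) (u : V) : V →L[ℝ] V →L[ℝ] ℝ :=
  LinearMap.toContinuousBilinearMap <| LinearMap.mk₂ ℝ
    (fun v w => g.val (φ u) (push φ u v) (push φ u w))
    (by simp) (by simp) (by simp) (by simp)

@[simp] theorem Metric.hat_apply (g : Metric E M) (φ : OpenPartialHomeomorph V M) (u v w : V) :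
    g.hat φ u v w = g.val (φ u) (push φ u v) (push φ u w) := by
  simp [Metric.hat]

theorem Metric.contMDiffAt_apply (g : Metric E M) {p : M} {X Y : ∀ p : M, TangentSpace 𝓘(ℝ, E) p}
    (hX : SmoothFieldAt X p) (hY : SmoothFieldAt Y p) :
    ContMDiffAt 𝓘(ℝ, E) 𝓘(ℝ, ℝ) ∞ (fun q => g.val q (X q) (Y q)) p := by
  have h := ContMDiffAt.clm_bundle_apply₂ (F₁ := E) (F₂ := E) (F₃ := ℝ)
    (E₃ := Bundle.Trivial M ℝ) (b := fun q : M => q) (ψ := g.val) g.contMDiff.contMDiffAt hX hY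
  exact (Bundle.contMDiffAt_totalSpace.1 h).2

/-- In finite dimension it suffices to evaluate on two fixed vectors, and these are the local
expressions of smooth fields. -/
theorem Metric.contDiffAt_hat (g : Metric E M) (hφ : IsParam (E := E) φ) (hu : u ∈ φ.source) :
    ContDiffAt ℝ ∞ (g.hat φ) u := by
  suffices h : ContDiffOn ℝ ∞ (g.hat φ) φ.source from h.contDiffAt (φ.open_source.mem_nhds hu)
  refine contDiffOn_clm_apply.2 fun v => contDiffOn_clm_apply.2 fun w z hz =>
    ContDiffAt.contDiffWithinAt ?_
  have hv := hφ.smoothFieldAt_pushField hz (contDiffAt_const (c := v))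
  have hw := hφ.smoothFieldAt_pushField hz (contDiffAt_const (c := w))
  refine ((g.contMDiffAt_apply hv hw).comp z (hφ.contMDiffAt hz)).contDiffAt.congr_of_eventuallyEq ?_
  filter_upwards [φ.open_source.mem_nhds hz] with y hy
  simp [hφ.pushField_apply hy]

theorem Metric.hat_symm (g : Metric E M) (φ : OpenPartialHomeomorph V M) (u v w : V) :
    g.hat φ u v w = g.hat φ u w v := by
  simp [g.symm]

theorem Metric.hat_pull (g : Metric E M) (hφ : IsParam (E := E) φ) (hu : u ∈ φ.source)
    (X Y : ∀ p : M, TangentSpace 𝓘(ℝ, E) p) :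
    g.hat φ u (pull φ X u) (pull φ Y u) = g.val (φ u) (X (φ u)) (Y (φ u)) := by
  simp [hφ.push_pull hu]

theorem Metric.eq_zero_of_hat (g : Metric E M) (hφ : IsParam (E := E) φ) (hu : u ∈ φ.source) {v : V}
    (h : ∀ w, g.hat φ u v w = 0) : v = 0 := by
  apply hφ.push_injective hu
  rw [map_zero]
  refine g.nondegenerate _ _ fun w => ?_
  obtain ⟨w, rfl⟩ := hφ.push_surjective hu w
  simpa using h w

theorem Metric.differentiableAt_hat (g : Metric E M) (hφ : IsParam (E := E) φ)
    (hu : u ∈ φ.source) : DifferentiableAt ℝ (g.hat φ) u :=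
  (g.contDiffAt_hat hφ hu).differentiableAt (by simp)

theorem Metric.hasFDerivAt_hat_apply (g : Metric E M) (hφ : IsParam (E := E) φ)
    (hu : u ∈ φ.source) {F G : V → V} (hF : DifferentiableAt ℝ F u)
    (hG : DifferentiableAt ℝ G u) (v : V) :
    DifferentiableAt ℝ (fun w => g.hat φ w (F w) (G w)) u ∧
    fderiv ℝ (fun w => g.hat φ w (F w) (G w)) u v = fderiv ℝ (g.hat φ) u v (F u) (G u)
      + g.hat φ u (fderiv ℝ F u v) (G u) + g.hat φ u (F u) (fderiv ℝ G u v) := by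
  have h := ((g.differentiableAt_hat hφ hu).hasFDerivAt.clm_apply hF.hasFDerivAt).clm_apply
    hG.hasFDerivAt
  refine ⟨h.differentiableAt, ?_⟩
  rw [h.fderiv]
  simp only [add_apply, ContinuousLinearMap.comp_apply,
    ContinuousLinearMap.flip_apply]
  ring

theorem Metric.fderiv_hat_symm (g : Metric E M) (hφ : IsParam (E := E) φ) (hu : u ∈ φ.source)
    (v x y : V) : fderiv ℝ (g.hat φ) u v x y = fderiv ℝ (g.hat φ) u v y x := by
  have h (x y : V) := (g.hasFDerivAt_hat_apply hφ hu (differentiableAt_const x)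
    (differentiableAt_const y) v).2
  have hxy := h x y
  have hyx := h y x
  simp_rw [fderiv_fun_const, Pi.zero_apply, zero_apply, map_zero,
    zero_apply, add_zero] at hxy hyx
  rw [← hxy, ← hyx]
  simp_rw [g.hat_symm φ _ x y]

theorem Metric.diff_val_push (g : Metric E M) (hφ : IsParam (E := E) φ) (hu : u ∈ φ.source)
    {X Y : ∀ p : M, TangentSpace 𝓘(ℝ, E) p} (hX : SmoothFieldAt X (φ u))
    (hY : SmoothFieldAt Y (φ u)) (v : V) :
    diff (fun q => g.val q (X q) (Y q)) (φ u) (push (E := E) φ u v) =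
      fderiv ℝ (g.hat φ) u v (pull φ X u) (pull φ Y u)
      + g.hat φ u (fderiv ℝ (pull φ X) u v) (pull φ Y u)
      + g.hat φ u (pull φ X u) (fderiv ℝ (pull φ Y) u v) := by
  have h := g.hasFDerivAt_hat_apply hφ hu
    ((hφ.contDiffAt_pull hu hX).differentiableAt (by simp))
    ((hφ.contDiffAt_pull hu hY).differentiableAt (by simp)) v
  have he : (fun w => g.val (φ w) (X (φ w)) (Y (φ w))) =ᶠ[nhds u]
      fun w => g.hat φ w (pull φ X w) (pull φ Y w) := by
    filter_upwards [φ.open_source.mem_nhds hu] with w hw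
    rw [g.hat_pull hφ hw]
  rw [hφ.diff_push hu (h.1.congr_of_eventuallyEq he), he.fderiv_eq, h.2]

/-- The derivatives of `Z` from the product rule cancel against those in the brackets, as do those
of `X`; only the Christoffel terms and the derivative of `Y` along `X` survive. The result depends
on `Z` through its value alone. -/
theorem Metric.koszul_eq (g : Metric E M) (hφ : IsParam (E := E) φ) (hu : u ∈ φ.source)
    {X Y Z : ∀ p : M, TangentSpace 𝓘(ℝ, E) p} (hX : SmoothFieldAt X (φ u))
    (hY : SmoothFieldAt Y (φ u)) (hZ : SmoothFieldAt Z (φ u)) :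
    g.koszul X Y Z (φ u) =
      fderiv ℝ (g.hat φ) u (pull φ X u) (pull φ Y u) (pull φ Z u)
      + fderiv ℝ (g.hat φ) u (pull φ Y u) (pull φ X u) (pull φ Z u)
      - fderiv ℝ (g.hat φ) u (pull φ Z u) (pull φ X u) (pull φ Y u)
      + 2 * g.hat φ u (fderiv ℝ (pull φ Y) u (pull φ X u)) (pull φ Z u) := by
  unfold Metric.koszul
  rw [← hφ.push_pull hu X, ← hφ.push_pull hu Y, ← hφ.push_pull hu Z,
    ← hφ.push_pull hu (VectorField.mlieBracket 𝓘(ℝ, E) X Y),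
    ← hφ.push_pull hu (VectorField.mlieBracket 𝓘(ℝ, E) X Z),
    ← hφ.push_pull hu (VectorField.mlieBracket 𝓘(ℝ, E) Y Z),
    g.diff_val_push hφ hu hX hY, g.diff_val_push hφ hu hX hZ, g.diff_val_push hφ hu hY hZ,
    ← g.hat_apply, ← g.hat_apply, ← g.hat_apply,
    hφ.pull_mlieBracket hu hX hY, hφ.pull_mlieBracket hu hX hZ, hφ.pull_mlieBracket hu hY hZ]
  simp only [map_sub, sub_apply]
  rw [g.hat_symm φ u (pull φ Y u) (fderiv ℝ (pull φ Z) u (pull φ X u)),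
    g.hat_symm φ u (pull φ X u) (fderiv ℝ (pull φ Z) u (pull φ Y u)),
    g.hat_symm φ u (pull φ X u) (fderiv ℝ (pull φ Y) u (pull φ Z u))]
  ring

theorem Metric.val_leviCivita (g : Metric E M) (hφ : IsParam (E := E) φ) (hu : u ∈ φ.source)
    {X Y : ∀ p : M, TangentSpace 𝓘(ℝ, E) p} (hX : SmoothFieldAt X (φ u))
    (hY : SmoothFieldAt Y (φ u)) (v : V) :
    g.val (φ u) (g.leviCivita X Y (φ u)) (push φ u v) =
      (1 / 2 : ℝ) * (fderiv ℝ (g.hat φ) u (pull φ X u) (pull φ Y u) v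
        + fderiv ℝ (g.hat φ) u (pull φ Y u) (pull φ X u) v
        - fderiv ℝ (g.hat φ) u v (pull φ X u) (pull φ Y u))
      + g.hat φ u (fderiv ℝ (pull φ Y) u (pull φ X u)) v := by
  -- The right-hand side as a linear functional of `v`. By `koszul_eq` it agrees on the basis with
  -- the functional defining the connection, hence everywhere.
  let R : V →L[ℝ] ℝ := (1 / 2 : ℝ) • (fderiv ℝ (g.hat φ) u (pull φ X u) (pull φ Y u)
        + fderiv ℝ (g.hat φ) u (pull φ Y u) (pull φ X u)
        - ((fderiv ℝ (g.hat φ) u).flip (pull φ X u)).flip (pull φ Y u))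
      + g.hat φ u (fderiv ℝ (pull φ Y) u (pull φ X u))
  have hR : ((Module.finBasis ℝ (TangentSpace 𝓘(ℝ, E) (φ u))).constr ℝ fun a =>
      (1 / 2 : ℝ) * g.koszul X Y (FiberBundle.extend E
        (Module.finBasis ℝ (TangentSpace 𝓘(ℝ, E) (φ u)) a)) (φ u)) =
      (R.comp (push (E := E) φ u).inverse).toLinearMap := by
    refine (Module.finBasis ℝ (TangentSpace 𝓘(ℝ, E) (φ u))).ext fun a => ?_
    set b := Module.finBasis ℝ (TangentSpace 𝓘(ℝ, E) (φ u)) a with hb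
    have hZ : SmoothFieldAt (FiberBundle.extend E b) (φ u) :=
      FiberBundle.contMDiffAt_extend _ _ _
    have hp : (push (E := E) φ u).inverse b = pull φ (FiberBundle.extend E b) u := by
      rw [pull, FiberBundle.extend_apply_self]
    rw [Module.Basis.constr_basis, g.koszul_eq hφ hu hX hY hZ, ContinuousLinearMap.coe_coe,
      ContinuousLinearMap.comp_apply, hp]
    simp only [R, add_apply, smul_apply,
      sub_apply, ContinuousLinearMap.flip_apply, smul_eq_mul]
    ring
  rw [Metric.leviCivita, g.val_sharp, hR, ContinuousLinearMap.coe_coe,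
      ContinuousLinearMap.comp_apply, (hφ.isInvertible_push hu).inverse_apply_self]
  simp only [R, add_apply, smul_apply,
      sub_apply, ContinuousLinearMap.flip_apply, smul_eq_mul]

end

/-! ### Splittings by constant projections and the second fundamental form. -/

section

variable {E M V : Type*} [NormedAddCommGroup E] [NormedSpace ℝ E] [FiniteDimensional ℝ E]
  [TopologicalSpace M] [ChartedSpace E M] [IsManifold 𝓘(ℝ, E) ∞ M]
  [NormedAddCommGroup V] [NormedSpace ℝ V] [FiniteDimensional ℝ V]

variable {φ : OpenPartialHomeomorph V M} {u : V} {ι : Type*} [Fintype ι] [DecidableEq ι]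

/-- A parametrization adapted to an orthogonal splitting `D` of the tangent bundle: in the
parametrization, `D i` is the range of the constant projection `P i`. -/
structure Metric.IsAdapted (g : Metric E M) (D : ι → ∀ p : M, Submodule ℝ (TangentSpace 𝓘(ℝ, E) p))
    (φ : OpenPartialHomeomorph V M) (P : ι → V →L[ℝ] V) : Prop where
  isParam : IsParam (E := E) φ
  sum_proj : ∀ v, ∑ i, P i v = v
  proj_proj : ∀ i v, P i (P i v) = P i v
  proj_proj_of_ne : ∀ i j, i ≠ j → ∀ v, P i (P j v) = 0
  mem_iff : ∀ u ∈ φ.source, ∀ i v, push φ u v ∈ D i (φ u) ↔ P i v = v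
  orthogonal : ∀ i j, i ≠ j → ∀ p, ∀ v ∈ D i p, ∀ w ∈ D j p, g.val p v w = 0

variable {g : Metric E M} {D : ι → ∀ p : M, Submodule ℝ (TangentSpace 𝓘(ℝ, E) p)}
  {P : ι → V →L[ℝ] V}

theorem Metric.IsAdapted.push_proj_mem (h : g.IsAdapted D φ P) (hu : u ∈ φ.source) (i : ι)
    (v : V) : push φ u (P i v) ∈ D i (φ u) :=
  (h.mem_iff u hu i _).2 (h.proj_proj i v)

theorem Metric.IsAdapted.hat_proj_proj (h : g.IsAdapted D φ P) (hu : u ∈ φ.source) {i j : ι}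
    (hij : i ≠ j) (v w : V) : g.hat φ u (P i v) (P j w) = 0 := by
  rw [g.hat_apply]
  exact h.orthogonal i j hij _ _ (h.push_proj_mem hu i v) _ (h.push_proj_mem hu j w)

theorem Metric.IsAdapted.hat_proj_left (h : g.IsAdapted D φ P) (hu : u ∈ φ.source) (i : ι)
    (v w : V) : g.hat φ u (P i v) w = g.hat φ u (P i v) (P i w) := by
  conv_lhs => rw [← h.sum_proj w, map_sum]
  exact Finset.sum_eq_single i (fun j _ hj => h.hat_proj_proj hu hj.symm v w) (by simp)

theorem Metric.IsAdapted.hat_proj_comm (h : g.IsAdapted D φ P) (hu : u ∈ φ.source) (i : ι)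
    (v w : V) : g.hat φ u (P i v) w = g.hat φ u v (P i w) := by
  rw [h.hat_proj_left hu i v w, g.hat_symm φ u v (P i w), h.hat_proj_left hu i w v,
    g.hat_symm φ u (P i v)]

/-- Self-adjointness of `P i` holds at all nearby points and `P i` is constant, so it can be
differentiated. In particular the derivatives of `ĝ` have no mixed blocks. -/
theorem Metric.IsAdapted.fderiv_hat_proj_comm (h : g.IsAdapted D φ P) (hu : u ∈ φ.source)
    (i : ι) (z v w : V) :
    fderiv ℝ (g.hat φ) u z (P i v) w = fderiv ℝ (g.hat φ) u z v (P i w) := by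
  have h' (x y : V) := (g.hasFDerivAt_hat_apply h.isParam hu (differentiableAt_const x)
    (differentiableAt_const y) z).2
  simp_rw [fderiv_fun_const, Pi.zero_apply, zero_apply, map_zero, zero_apply, add_zero] at h'
  rw [← h', ← h']
  have he : (fun y => g.hat φ y (P i v) w) =ᶠ[nhds u] fun y => g.hat φ y v (P i w) := by
    filter_upwards [φ.open_source.mem_nhds hu] with y hy
    exact h.hat_proj_comm hy i v w
  rw [he.fderiv_eq]

theorem Metric.IsAdapted.isCompl (h : g.IsAdapted D φ P) (hu : u ∈ φ.source) (i : ι) :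
    IsCompl (D i (φ u)) (g.perp (φ u) (D i (φ u))) := by
  refine isCompl_iff.2 ⟨?_, ?_⟩
  · rw [Submodule.disjoint_def]
    intro v hv hv'
    obtain ⟨v, rfl⟩ := h.isParam.push_surjective hu v
    rw [g.eq_zero_of_hat h.isParam hu (v := v), map_zero]
    intro w
    rw [← (h.mem_iff u hu i v).1 hv, h.hat_proj_left hu, (h.mem_iff u hu i v).1 hv, g.hat_apply]
    exact hv' _ (h.push_proj_mem hu i w)
  · rw [codisjoint_iff, eq_top_iff]
    intro v _
    obtain ⟨v, rfl⟩ := h.isParam.push_surjective hu v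
    rw [← add_sub_cancel (P i v) v, map_add]
    refine Submodule.add_mem_sup (h.push_proj_mem hu i v) fun w hw => ?_
    obtain ⟨w, rfl⟩ := h.isParam.push_surjective hu w
    rw [← (h.mem_iff u hu i w).1 hw, ← g.hat_apply, ← h.hat_proj_comm hu, map_sub,
      h.proj_proj, sub_self, map_zero, zero_apply]

theorem Metric.IsAdapted.proj_push (h : g.IsAdapted D φ P) (hu : u ∈ φ.source) (i : ι) (v : V) :
    g.proj (φ u) (D i (φ u)) (push φ u v) = push φ u (P i v) := by
  rw [Metric.proj, dif_pos (h.isCompl hu i)]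
  conv_lhs => rw [← add_sub_cancel (P i v) v, map_add, map_add]
  rw [Submodule.projection_apply_of_mem_left _ (h.push_proj_mem hu i v),
    (Submodule.projection_apply_eq_zero_iff _).2, add_zero]
  intro w hw
  obtain ⟨w, rfl⟩ := h.isParam.push_surjective hu w
  rw [← (h.mem_iff u hu i w).1 hw, ← g.hat_apply, ← h.hat_proj_comm hu, map_sub,
      h.proj_proj, sub_self, map_zero, zero_apply]

/-- Pairing with the normal part of `v` leaves three Koszul terms and the derivative of `Y`. That
derivative is tangent to the distribution, and the two terms pairing a tangent vector with the
normal one are mixed blocks; only the derivative of `ĝ` in the normal direction remains. -/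
theorem Metric.IsAdapted.val_sff (h : g.IsAdapted D φ P) (hu : u ∈ φ.source) (i : ι)
    {X Y : ∀ p : M, TangentSpace 𝓘(ℝ, E) p} (hX : SmoothFieldAt X (φ u))
    (hY : SmoothFieldAt Y (φ u)) (hXD : P i (pull φ X u) = pull φ X u)
    (hYD : ∀ᶠ w in nhds u, P i (pull φ Y w) = pull φ Y w) (v : V) :
    g.val (φ u) (g.sff (D i) X Y (φ u)) (push φ u v) =
      -(1 / 2 : ℝ) * fderiv ℝ (g.hat φ) u (v - P i v) (pull φ X u) (pull φ Y u) := by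
  have hlc (v : V) := g.val_leviCivita h.isParam hu hX hY v
  set n := g.leviCivita X Y (φ u)
  obtain ⟨n', hn⟩ := h.isParam.push_surjective hu n
  -- Differentiate `P i ∘ pull φ Y = pull φ Y`, which holds near `u`.
  have hYd : P i (fderiv ℝ (pull φ Y) u (pull φ X u)) = fderiv ℝ (pull φ Y) u (pull φ X u) := by
    have hY' := ((h.isParam.contDiffAt_pull hu hY).differentiableAt (by simp))
    have := ((P i).hasFDerivAt.comp u hY'.hasFDerivAt).fderiv
    rw [Filter.EventuallyEq.fderiv_eq (f₁ := P i ∘ pull φ Y) hYD] at this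
    exact (DFunLike.congr_fun this _).symm
  have hP : P i (v - P i v) = 0 := by rw [map_sub, h.proj_proj, sub_self]
  have hl : g.val (φ u) (g.sff (D i) X Y (φ u)) (push φ u v) =
      g.val (φ u) n (push φ u (v - P i v)) := by
    rw [Metric.sff, show g.leviCivita X Y (φ u) = push φ u n' from hn.symm, ← hn, h.proj_push hu, ← map_sub, ← g.hat_apply, ← g.hat_apply]
    simp only [map_sub, sub_apply]
    rw [h.hat_proj_comm hu]
  rw [hl, hlc, ← hYd, h.hat_proj_comm hu, ← hXD, ← hYD.self_of_nhds,
    h.fderiv_hat_proj_comm hu, h.fderiv_hat_proj_comm hu, hP]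
  simp only [map_zero]
  rw [hXD, hYD.self_of_nhds]
  ring

theorem Metric.IsAdapted.smoothFieldAt_extendIn (h : g.IsAdapted D φ P) (hu : u ∈ φ.source)
    (i : ι) (x : TangentSpace 𝓘(ℝ, E) (φ u)) :
    SmoothFieldAt (g.extendIn (D i) (φ u) x) (φ u) := by
  have hx : SmoothFieldAt (FiberBundle.extend E x) (φ u) :=
    FiberBundle.contMDiffAt_extend _ _ _
  have hF : ContDiffAt ℝ ∞ (fun w => P i (pull φ (FiberBundle.extend E x) w)) u :=
    (P i).contDiff.contDiffAt.comp u (h.isParam.contDiffAt_pull hu hx)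
  refine (h.isParam.smoothFieldAt_pushField hu hF).congr_of_eventuallyEq ?_
  filter_upwards [φ.open_target.mem_nhds (φ.map_source hu)] with q hq
  obtain ⟨w, hw, rfl⟩ : ∃ w ∈ φ.source, φ w = q := ⟨φ.symm q, φ.map_target hq, φ.right_inv hq⟩
  rw [h.isParam.pushField_apply hw, ← h.proj_push hw, h.isParam.push_pull hw]
  rfl

theorem Metric.IsAdapted.pull_extendIn (h : g.IsAdapted D φ P) (hu : u ∈ φ.source)
    (i : ι) (p : M) (x : TangentSpace 𝓘(ℝ, E) p) :
    pull φ (g.extendIn (D i) p x) u = P i (pull φ (FiberBundle.extend E x) u) := by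
  refine pull_eq_of_push_eq h.isParam hu ?_
  rw [← h.proj_push hu, h.isParam.push_pull hu]
  rfl

theorem Metric.IsAdapted.val_symmSff (h : g.IsAdapted D φ P) (hu : u ∈ φ.source) (i : ι)
    {x y : V} (hx : P i x = x) (hy : P i y = y) (v : V) :
    g.val (φ u) (g.symmSff (D i) (φ u) (push φ u x) (push φ u y)) (push φ u v) =
      -(1 / 2 : ℝ) * fderiv ℝ (g.hat φ) u (v - P i v) x y := by
  have hp {x : V} (hx : P i x = x) :
      pull φ (g.extendIn (D i) (φ u) (push φ u x)) u = x := by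
    rw [h.pull_extendIn hu, pull, FiberBundle.extend_apply_self,
      (h.isParam.isInvertible_push hu).inverse_apply_self, hx]
  have hD (x : V) : ∀ᶠ w in nhds u, P i (pull φ (g.extendIn (D i) (φ u) (push φ u x)) w) =
      pull φ (g.extendIn (D i) (φ u) (push φ u x)) w := by
    filter_upwards [φ.open_source.mem_nhds hu] with w hw
    rw [h.pull_extendIn hw, h.proj_proj]
  have hs (x : V) := h.smoothFieldAt_extendIn hu i (push φ u x)
  rw [Metric.symmSff, map_smul, map_add, smul_apply, add_apply,
    h.val_sff hu i (hs x) (hs y) (hD x).self_of_nhds (hD y),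
    h.val_sff hu i (hs y) (hs x) (hD y).self_of_nhds (hD x), hp hx, hp hy,
    g.fderiv_hat_symm h.isParam hu _ y x]
  rw [smul_eq_mul]
  ring

/-- The trace of `g|_D` with respect to itself is the rank of `D`, which cancels the normalizing
factor. The rank must be nonzero, since otherwise that factor is `0⁻¹ = 0`. -/
theorem Metric.meanCurvatureNormal_eq (g : Metric E M)
    (D : ∀ p : M, Submodule ℝ (TangentSpace 𝓘(ℝ, E) p)) (p : M) (N : TangentSpace 𝓘(ℝ, E) p)
    (hD : D p ≠ ⊥) (hnd : ∀ v ∈ D p, (∀ w ∈ D p, g.val p v w = 0) → v = 0)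
    (h : ∀ x ∈ D p, ∀ y ∈ D p, g.symmSff D p x y = g.val p x y • N) :
    g.meanCurvatureNormal D p = N := by
  -- A null vector of the Gram matrix is the coordinate vector of an element of `D p` orthogonal to
  -- `D p`.
  have hdet : IsUnit (g.gram D p).det := by
    rw [isUnit_iff_ne_zero]
    intro h0
    obtain ⟨v, hv, hv0⟩ := Matrix.exists_vecMul_eq_zero_iff.2 h0
    apply hv
    set b := Module.finBasis ℝ (D p)
    have hz : ((∑ a, v a • b a : D p) : TangentSpace 𝓘(ℝ, E) p) = 0 := by
      refine hnd _ (Subtype.property _) fun w hw => ?_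
      have hr : (⟨w, hw⟩ : D p) = ∑ a, b.repr ⟨w, hw⟩ a • b a := (b.sum_repr _).symm
      have hw' : w = ∑ a, b.repr ⟨w, hw⟩ a • (b a : TangentSpace 𝓘(ℝ, E) p) := by
        have := congrArg (Subtype.val) hr
        rwa [Submodule.coe_sum] at this
      rw [hw', map_sum]
      refine Finset.sum_eq_zero fun c _ => ?_
      have := congrFun hv0 c
      simp only [Matrix.vecMul, dotProduct, Metric.gram, Matrix.of_apply, Pi.zero_apply] at this
      rw [map_smul]
      simp only [Submodule.coe_sum, Submodule.coe_smul, map_sum, map_smul, sum_apply,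
        smul_apply, smul_eq_mul]
      rw [this, mul_zero]
    have := Fintype.linearIndependent_iff.1 b.linearIndependent v (Subtype.ext hz)
    exact funext this
  have hm : (Module.finrank ℝ (D p) : ℝ) ≠ 0 := by
    rw [Nat.cast_ne_zero]
    exact fun h0 => hD (Submodule.finrank_eq_zero.1 h0)
  have key : ∑ a, ∑ b, (g.gram D p)⁻¹ a b * g.gram D p b a = Module.finrank ℝ (D p) := by
    have := congrArg Matrix.trace (Matrix.nonsing_inv_mul _ hdet)
    rw [Matrix.trace_one, Fintype.card_fin] at this
    simpa [Matrix.trace, Matrix.mul_apply] using this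
  have hs : ∑ a, ∑ b, (g.gram D p)⁻¹ a b •
      g.symmSff D p (Module.finBasis ℝ (D p) a) (Module.finBasis ℝ (D p) b) =
      (Module.finrank ℝ (D p) : ℝ) • N := by
    rw [← key, Finset.sum_smul]
    refine Finset.sum_congr rfl fun a _ => ?_
    rw [Finset.sum_smul]
    refine Finset.sum_congr rfl fun b _ => ?_
    rw [h _ (Subtype.property _) _ (Subtype.property _), smul_smul, g.symm]
    rfl
  rw [Metric.meanCurvatureNormal, hs, smul_smul, inv_mul_cancel₀ hm, one_smul]

/-- Existence of adapted parametrizations. -/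
theorem Metric.IsIntegrableNet.exists_isAdapted (h : g.IsIntegrableNet D) (p : M) :
    ∃ (m : ι → ℕ) (φ : OpenPartialHomeomorph (∀ i, EuclideanSpace ℝ (Fin (m i))) M)
      (P : ι → (∀ i, EuclideanSpace ℝ (Fin (m i))) →L[ℝ] (∀ i, EuclideanSpace ℝ (Fin (m i)))),
      g.IsAdapted D φ P ∧ p ∈ φ.target := by
  obtain ⟨m, U, φ, -, -, hp, hs, hs', hD⟩ := h.adapted p
  -- The projections are those of the product onto its factors.
  refine ⟨m, φ, fun i => (ContinuousLinearMap.single ℝ _ i).comp (ContinuousLinearMap.proj i),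
    ⟨⟨hs, hs'⟩, fun v => ?_, fun i v => ?_, fun i j hij v => ?_, fun u hu i v => ?_,
      h.orthogonal⟩, hp⟩
  · simp [Finset.univ_sum_single]
  · simp
  · simp [hij]
  · have hpar : IsParam (E := E) φ := ⟨hs, hs'⟩
    have hv := Set.ext_iff.1 (hD u hu i) (push φ u v)
    refine hv.trans ⟨?_, fun hv => ⟨v i, congrArg (push (E := E) φ u) hv⟩⟩
    rintro ⟨w, hw⟩
    obtain rfl : Pi.single i w = v := hpar.push_injective hu hw
    simp

/-- A vector of `D i` extends to a smooth section of `D i`. -/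
theorem Metric.IsAdapted.exists_section [T2Space M] (h : g.IsAdapted D φ P) (hu : u ∈ φ.source)
    (i : ι) {x : V} (hx : P i x = x) :
    ∃ X : ∀ p : M, TangentSpace 𝓘(ℝ, E) p, IsSmoothField X ∧ (∀ p, X p ∈ D i p) ∧
      pull φ X u = x := by
  -- A bump function supported in the chart cuts off the constant field `x`; away from the chart the
  -- section is zero, which lies in every subspace.
  obtain ⟨ψ, -, hψ⟩ := (SmoothBumpFunction.nhds_basis_tsupport (I := 𝓘(ℝ, E)) (φ u)).mem_iff.1
    (φ.open_target.mem_nhds (φ.map_source hu))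
  refine ⟨(ψ : M → ℝ) • pushField φ (fun _ => x), ?_, fun p => ?_, ?_⟩
  · refine ContMDiffOn.smul_section_of_tsupport (V := fun p : M => TangentSpace 𝓘(ℝ, E) p)
      ψ.contMDiff.contMDiffOn φ.open_target hψ fun q hq => ?_
    obtain ⟨w, hw, rfl⟩ : ∃ w ∈ φ.source, φ w = q := ⟨φ.symm q, φ.map_target hq, φ.right_inv hq⟩
    exact (h.isParam.smoothFieldAt_pushField hw contDiffAt_const).contMDiffWithinAt
  · by_cases hp : p ∈ φ.target
    · obtain ⟨w, hw, rfl⟩ : ∃ w ∈ φ.source, φ w = p :=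
        ⟨φ.symm p, φ.map_target hp, φ.right_inv hp⟩
      refine Submodule.smul_mem _ _ ?_
      rw [h.isParam.pushField_apply hw]
      exact (h.mem_iff w hw i x).2 hx
    · have : ψ p = 0 := image_eq_zero_of_notMem_tsupport fun h' => hp (hψ h')
      simp [this]
  · refine pull_eq_of_push_eq h.isParam hu ?_
    simp [h.isParam.pushField_apply hu]

end

section

variable {E M V : Type*} [NormedAddCommGroup E] [NormedSpace ℝ E] [FiniteDimensional ℝ E]
  [TopologicalSpace M] [ChartedSpace E M] [IsManifold 𝓘(ℝ, E) ∞ M]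
  [NormedAddCommGroup V] [NormedSpace ℝ V] [FiniteDimensional ℝ V]

variable {φ : OpenPartialHomeomorph V M} {u : V} {ι : Type*} [Fintype ι] [DecidableEq ι]

/-! ### Gradients in a parametrization -/

theorem Metric.val_sharp_eq (g : Metric E M) (p : M) (α : TangentSpace 𝓘(ℝ, E) p →L[ℝ] ℝ) :
    g.val p (g.sharp p α.toLinearMap) = α := by
  ext v
  exact g.val_sharp p _ v

theorem Metric.isInvertible_hat (g : Metric E M) (hφ : IsParam (E := E) φ) (hu : u ∈ φ.source) :
    (g.hat φ u).IsInvertible := by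
  have hb : Function.Bijective (g.hat φ u).toLinearMap := by
    refine ⟨(injective_iff_map_eq_zero _).2 fun v hv => g.eq_zero_of_hat hφ hu fun w =>
      DFunLike.congr_fun hv w, fun α => ?_⟩
    obtain ⟨v, hv⟩ := hφ.push_surjective hu
      (g.sharp (φ u) (α.comp (push (E := E) φ u).inverse).toLinearMap)
    refine ⟨v, ContinuousLinearMap.ext fun w => ?_⟩
    rw [ContinuousLinearMap.coe_coe, g.hat_apply, hv, g.val_sharp, ContinuousLinearMap.coe_coe,
      ContinuousLinearMap.comp_apply, (hφ.isInvertible_push hu).inverse_apply_self]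
  exact ⟨(LinearEquiv.ofBijective _ hb).toContinuousLinearEquiv, rfl⟩

/-- The expression in a parametrization of the gradient of a function. -/
def Metric.gradHat (g : Metric E M) (φ : OpenPartialHomeomorph V M) (f : M → ℝ) (u : V) : V :=
  (g.hat φ u).inverse (fderiv ℝ (fun w => f (φ w)) u)

theorem Metric.hat_gradHat (g : Metric E M) (hφ : IsParam (E := E) φ) (hu : u ∈ φ.source)
    (f : M → ℝ) : g.hat φ u (g.gradHat φ f u) = fderiv ℝ (fun w => f (φ w)) u :=
  (g.isInvertible_hat hφ hu).self_apply_inverse _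

theorem Metric.grad_eq_push (g : Metric E M) (hφ : IsParam (E := E) φ) (hu : u ∈ φ.source)
    {f : M → ℝ} (hf : DifferentiableAt ℝ (fun w => f (φ w)) u) :
    g.grad f (φ u) = push φ u (g.gradHat φ f u) := by
  rw [← sub_eq_zero]
  refine g.nondegenerate _ _ fun w => ?_
  obtain ⟨w, rfl⟩ := hφ.push_surjective hu w
  rw [map_sub, sub_apply, Metric.grad, g.val_sharp, ContinuousLinearMap.coe_coe,
    hφ.diff_push hu hf, ← g.hat_apply, g.hat_gradHat hφ hu, sub_self]

theorem IsParam.contDiffAt_comp (hφ : IsParam (E := E) φ) (hu : u ∈ φ.source) {f : M → ℝ}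
    (hf : ContMDiff 𝓘(ℝ, E) 𝓘(ℝ, ℝ) ∞ f) : ContDiffAt ℝ ∞ (fun w => f (φ w)) u :=
  (hf.contMDiffAt.comp u (hφ.contMDiffAt hu)).contDiffAt

theorem IsParam.differentiableAt_comp (hφ : IsParam (E := E) φ) (hu : u ∈ φ.source) {f : M → ℝ}
    (hf : ContMDiff 𝓘(ℝ, E) 𝓘(ℝ, ℝ) ∞ f) : DifferentiableAt ℝ (fun w => f (φ w)) u :=
  (hφ.contDiffAt_comp hu hf).differentiableAt (by simp)

theorem IsParam.differentiableAt_fderiv (hφ : IsParam (E := E) φ) (hu : u ∈ φ.source) {f : M → ℝ}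
    (hf : ContMDiff 𝓘(ℝ, E) 𝓘(ℝ, ℝ) ∞ f) :
    DifferentiableAt ℝ (fderiv ℝ (fun w => f (φ w))) u :=
  ((hφ.contDiffAt_comp hu hf).fderiv_right (m := 1) (by
    exact WithTop.coe_le_coe.2 (le_top : (1 + 1 : ℕ∞) ≤ ⊤))).differentiableAt one_ne_zero

theorem IsParam.hessian_symm (hφ : IsParam (E := E) φ) (hu : u ∈ φ.source) {f : M → ℝ}
    (hf : ContMDiff 𝓘(ℝ, E) 𝓘(ℝ, ℝ) ∞ f) (v w : V) :
    fderiv ℝ (fderiv ℝ (fun w => f (φ w))) u v w =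
      fderiv ℝ (fderiv ℝ (fun w => f (φ w))) u w v :=
  (hφ.contDiffAt_comp hu hf).isSymmSndFDerivAt (by
    rw [minSmoothness_of_isRCLikeNormedField]
    exact WithTop.coe_le_coe.2 (le_top : (2 : ℕ∞) ≤ ⊤)) v w

theorem Metric.differentiableAt_gradHat (g : Metric E M) (hφ : IsParam (E := E) φ)
    (hu : u ∈ φ.source) {f : M → ℝ} (hf : ContMDiff 𝓘(ℝ, E) 𝓘(ℝ, ℝ) ∞ f) :
    DifferentiableAt ℝ (g.gradHat φ f) u := by
  have := FiniteDimensional.complete ℝ V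
  have h := ((g.isInvertible_hat hφ hu).contDiffAt_map_inverse (n := ∞)).differentiableAt (by simp)
  exact (h.comp u (g.differentiableAt_hat hφ hu)).clm_apply (hφ.differentiableAt_fderiv hu hf)

/-- Differentiate `ĝ(grad f, v) = df(v)` with `v` constant. This trades derivatives of gradients for
Hessians and derivatives of `ĝ`. -/
theorem Metric.hat_fderiv_gradHat (g : Metric E M) (hφ : IsParam (E := E) φ) (hu : u ∈ φ.source)
    {f : M → ℝ} (hf : ContMDiff 𝓘(ℝ, E) 𝓘(ℝ, ℝ) ∞ f) (z v : V) :
    g.hat φ u (fderiv ℝ (g.gradHat φ f) u z) v =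
      fderiv ℝ (fderiv ℝ (fun w => f (φ w))) u z v
        - fderiv ℝ (g.hat φ) u z (g.gradHat φ f u) v := by
  have h := (g.hasFDerivAt_hat_apply hφ hu (g.differentiableAt_gradHat hφ hu hf)
    (differentiableAt_const v) z).2
  have he : (fun w => g.hat φ w (g.gradHat φ f w) v) =ᶠ[nhds u]
      fun w => fderiv ℝ (fun w => f (φ w)) w v := by
    filter_upwards [φ.open_source.mem_nhds hu] with w hw
    rw [g.hat_gradHat hφ hw]
  have h2 := ((hφ.differentiableAt_fderiv hu hf).hasFDerivAt.clm_apply (hasFDerivAt_const v u)).fderiv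
  rw [he.fderiv_eq, h2] at h
  simp only [add_apply, ContinuousLinearMap.comp_apply, ContinuousLinearMap.flip_apply,
    zero_apply, map_zero, zero_add, fderiv_fun_const, Pi.zero_apply, add_zero] at h
  rw [h]
  ring

/-- Every covector is the differential of a smooth function. -/
theorem IsParam.exists_fderiv_eq [T2Space M] (hφ : IsParam (E := E) φ) (hu : u ∈ φ.source)
    (α : V →L[ℝ] ℝ) : ∃ f : M → ℝ, ContMDiff 𝓘(ℝ, E) 𝓘(ℝ, ℝ) ∞ f ∧
      fderiv ℝ (fun w => f (φ w)) u = α := by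
  obtain ⟨ψ, -, hψ⟩ := (SmoothBumpFunction.nhds_basis_tsupport (I := 𝓘(ℝ, E)) (φ u)).mem_iff.1
    (φ.open_target.mem_nhds (φ.map_source hu))
  refine ⟨fun q => ψ q * α (φ.symm q), contMDiff_of_tsupport fun q hq => ?_, ?_⟩
  · have hq' : q ∈ φ.target := hψ (closure_mono (fun z hz => left_ne_zero_of_mul hz) hq)
    exact ψ.contMDiff.contMDiffAt.mul
      (α.contDiff.contDiffAt.contMDiffAt.comp q (hφ.contMDiffAt_symm hq'))
  · have he : (fun w => ψ (φ w) * α (φ.symm (φ w))) =ᶠ[nhds u] α := by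
      filter_upwards [φ.open_source.mem_nhds hu,
        (φ.continuousAt hu).eventually ψ.eventuallyEq_one] with w hw hw'
      rw [hw', φ.left_inv hw, Pi.one_apply, one_mul]
    rw [he.fderiv_eq, α.fderiv]

theorem Metric.exists_gradHat_eq [T2Space M] (g : Metric E M) (hφ : IsParam (E := E) φ)
    (hu : u ∈ φ.source) (x : V) : ∃ f : M → ℝ, ContMDiff 𝓘(ℝ, E) 𝓘(ℝ, ℝ) ∞ f ∧
      g.gradHat φ f u = x := by
  obtain ⟨f, hf, h⟩ := hφ.exists_fderiv_eq hu (g.hat φ u x)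
  exact ⟨f, hf, by rw [Metric.gradHat, h, (g.isInvertible_hat hφ hu).inverse_apply_self]⟩

/-! ### The tensor in a parametrization adapted to its eigenspaces -/

theorem SymTensor.val_flat (T : SymTensor E M) (g : Metric E M) (p : M)
    (v : TangentSpace 𝓘(ℝ, E) p) (β : TangentSpace 𝓘(ℝ, E) p →L[ℝ] ℝ) :
    T.val p (g.val p v) β = β (T.endo g p v) := by
  conv_rhs => rw [← g.val_sharp_eq p β, g.symm]
  refine Eq.trans ?_ (g.val_sharp p _ _).symm
  conv_lhs => rw [← g.val_sharp_eq p β]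
  rfl

theorem SymTensor.val_diff (T : SymTensor E M) (g : Metric E M) (f : M → ℝ) (p : M)
    (β : TangentSpace 𝓘(ℝ, E) p →L[ℝ] ℝ) :
    T.val p (diff f p) β = β (T.endo g p (g.grad f p)) := by
  rw [← T.val_flat, Metric.grad, g.val_sharp_eq]

theorem Metric.contra_diff (g : Metric E M) (f : M → ℝ) (p : M)
    (β : TangentSpace 𝓘(ℝ, E) p →L[ℝ] ℝ) :
    g.contra p (diff f p) β = β (g.grad f p) := by
  rw [Metric.contra, Metric.grad]
  conv_lhs => rw [← g.val_sharp_eq p (diff f p)]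
  rw [g.symm, g.val_sharp_eq]

variable {g : Metric E M} {T : SymTensor E M} {l : ι → M → ℝ} {P : ι → V →L[ℝ] V}

theorem Metric.IsAdapted.endo_push (h : g.IsAdapted (fun i => T.eigendist g (l i)) φ P)
    (hu : u ∈ φ.source) (x : V) :
    T.endo g (φ u) (push φ u x) = push φ u (∑ j, l j (φ u) • P j x) := by
  conv_lhs => rw [← h.sum_proj x]
  rw [map_sum, map_sum, map_sum]
  refine Finset.sum_congr rfl fun j _ => ?_
  rw [map_smul]
  exact Module.End.mem_eigenspace_iff.1 (h.push_proj_mem hu j x)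

/-- No regularity of `l i` is assumed. For a constant vector `x` in the range of `P i` and `y` with
`ĝ(x, y) ≠ 0`, the quotient `T(x♭, y♭) / ĝ(x, y)` equals `l i` near the point and is differentiable
because `T` and `g` are smooth. -/
theorem Metric.IsAdapted.differentiableAt_eigenfunction
    (h : g.IsAdapted (fun i => T.eigendist g (l i)) φ P) (hl : T.IsEigenfunctions g l)
    (hu : u ∈ φ.source) (i : ι) : DifferentiableAt ℝ (fun w => l i (φ w)) u := by
  have hφ := h.isParam
  obtain ⟨x, hx, hx0⟩ : ∃ x, P i x = x ∧ x ≠ 0 := by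
    obtain ⟨v, hv⟩ := ((hl.hasEigenvalue_iff (φ u) (l i (φ u))).2 ⟨i, rfl⟩).exists_hasEigenvector
    obtain ⟨x, rfl⟩ := hφ.push_surjective hu v
    refine ⟨x, (h.mem_iff u hu i x).1 hv.1, ?_⟩
    rintro rfl
    exact hv.2 (map_zero _)
  obtain ⟨y, hy⟩ : ∃ y, g.hat φ u x y ≠ 0 := by
    by_contra! hc
    exact hx0 (g.eq_zero_of_hat hφ hu hc)
  have hα (x : V) := ContMDiffAt.clm_bundle_apply (F₁ := E) (F₂ := E →L[ℝ] ℝ)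
    (E₂ := fun q : M => TangentSpace 𝓘(ℝ, E) q →L[ℝ] ℝ) (b := fun q : M => q) (ϕ := g.val)
    g.contMDiff.contMDiffAt (hφ.smoothFieldAt_pushField hu (contDiffAt_const (c := x)))
  have hT := ((T.contMDiffAt (φ u) _ _ (hα x) (hα y)).comp u (hφ.contMDiffAt hu)).contDiffAt
  have hg : DifferentiableAt ℝ (fun w => g.hat φ w x y) u :=
    (g.hasFDerivAt_hat_apply hφ hu (differentiableAt_const x) (differentiableAt_const y) 0).1
  refine ((hT.differentiableAt (by simp)).mul (hg.inv hy)).congr_of_eventuallyEq ?_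
  filter_upwards [φ.open_source.mem_nhds hu, hg.continuousAt.eventually_ne hy] with w hw hw'
  have he : T.endo g (φ w) (push φ w x) = l i (φ w) • push φ w x :=
    Module.End.mem_eigenspace_iff.1 ((h.mem_iff w hw i x).2 hx)
  rw [Pi.mul_apply, Pi.inv_apply, Function.comp_apply, hφ.pushField_apply hw, hφ.pushField_apply hw, T.val_flat,
    he, map_smul, g.symm, ← g.hat_apply, smul_eq_mul, mul_assoc, mul_inv_cancel₀ hw',
    mul_one]

/-! ### The Schouten bracket in an adapted parametrization. -/

/-- The cubic form whose symmetrization is the Schouten bracket of `T` and the metric in a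
parametrization adapted to the eigenspaces of `T`, with arguments the gradients of functions. -/
def Metric.bracketForm (g : Metric E M) (φ : OpenPartialHomeomorph V M) (P : ι → V →L[ℝ] V)
    (l : ι → M → ℝ) (u x y z : V) : ℝ :=
  -fderiv ℝ (g.hat φ) u (∑ j, l j (φ u) • P j x) y z
    + fderiv ℝ (g.hat φ) u x (∑ j, l j (φ u) • P j y) z
    - ∑ j, fderiv ℝ (fun w => l j (φ w)) u x * g.hat φ u (P j y) z

theorem Metric.contra_diff_diff (g : Metric E M) (hφ : IsParam (E := E) φ) (hu : u ∈ φ.source)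
    {a b : M → ℝ} (ha : ContMDiff 𝓘(ℝ, E) 𝓘(ℝ, ℝ) ∞ a) (hb : ContMDiff 𝓘(ℝ, E) 𝓘(ℝ, ℝ) ∞ b) :
    g.contra (φ u) (diff a (φ u)) (diff b (φ u)) =
      g.hat φ u (g.gradHat φ a u) (g.gradHat φ b u) := by
  rw [g.contra_diff, g.grad_eq_push hφ hu (hφ.differentiableAt_comp hu ha),
    hφ.diff_push hu (hφ.differentiableAt_comp hu hb), ← g.hat_gradHat hφ hu, g.hat_symm]

theorem Metric.IsAdapted.val_diff_diff (h : g.IsAdapted (fun i => T.eigendist g (l i)) φ P)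
    (hu : u ∈ φ.source) {a b : M → ℝ} (ha : ContMDiff 𝓘(ℝ, E) 𝓘(ℝ, ℝ) ∞ a)
    (hb : ContMDiff 𝓘(ℝ, E) 𝓘(ℝ, ℝ) ∞ b) :
    T.val (φ u) (diff a (φ u)) (diff b (φ u)) =
      ∑ j, l j (φ u) * g.hat φ u (P j (g.gradHat φ a u)) (g.gradHat φ b u) := by
  have hφ := h.isParam
  rw [T.val_diff g, g.grad_eq_push hφ hu (hφ.differentiableAt_comp hu ha), h.endo_push hu,
    hφ.diff_push hu (hφ.differentiableAt_comp hu hb), ← g.hat_gradHat hφ hu, g.hat_symm]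
  simp only [map_sum, map_smul, sum_apply, smul_apply, smul_eq_mul]

theorem Metric.IsAdapted.fderiv_contra_diff_diff
    (h : g.IsAdapted (fun i => T.eigendist g (l i)) φ P)
    (hu : u ∈ φ.source) {a b : M → ℝ} (ha : ContMDiff 𝓘(ℝ, E) 𝓘(ℝ, ℝ) ∞ a)
    (hb : ContMDiff 𝓘(ℝ, E) 𝓘(ℝ, ℝ) ∞ b) (z : V) :
    DifferentiableAt ℝ (fun w => g.contra (φ w) (diff a (φ w)) (diff b (φ w))) u ∧
    fderiv ℝ (fun w => g.contra (φ w) (diff a (φ w)) (diff b (φ w))) u z =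
      fderiv ℝ (fderiv ℝ (fun w => a (φ w))) u z (g.gradHat φ b u)
      + fderiv ℝ (fderiv ℝ (fun w => b (φ w))) u z (g.gradHat φ a u)
      - fderiv ℝ (g.hat φ) u z (g.gradHat φ a u) (g.gradHat φ b u) := by
  have hφ := h.isParam
  have he : (fun w => g.contra (φ w) (diff a (φ w)) (diff b (φ w))) =ᶠ[nhds u]
      fun w => g.hat φ w (g.gradHat φ a w) (g.gradHat φ b w) := by
    filter_upwards [φ.open_source.mem_nhds hu] with w hw
    exact g.contra_diff_diff hφ hw ha hb
  have hd := g.hasFDerivAt_hat_apply hφ hu (g.differentiableAt_gradHat hφ hu ha)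
    (g.differentiableAt_gradHat hφ hu hb) z
  refine ⟨hd.1.congr_of_eventuallyEq he, ?_⟩
  rw [he.fderiv_eq, hd.2, g.hat_fderiv_gradHat hφ hu ha,
    g.hat_symm φ u _ (fderiv ℝ (g.gradHat φ b) u z), g.hat_fderiv_gradHat hφ hu hb,
    g.fderiv_hat_symm hφ hu z (g.gradHat φ b u)]
  ring

theorem Metric.IsAdapted.fderiv_val_diff_diff
    (h : g.IsAdapted (fun i => T.eigendist g (l i)) φ P) (hl : T.IsEigenfunctions g l)
    (hu : u ∈ φ.source) {a b : M → ℝ} (ha : ContMDiff 𝓘(ℝ, E) 𝓘(ℝ, ℝ) ∞ a)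
    (hb : ContMDiff 𝓘(ℝ, E) 𝓘(ℝ, ℝ) ∞ b) (z : V) :
    DifferentiableAt ℝ (fun w => T.val (φ w) (diff a (φ w)) (diff b (φ w))) u ∧
    fderiv ℝ (fun w => T.val (φ w) (diff a (φ w)) (diff b (φ w))) u z =
      ∑ j, fderiv ℝ (fun w => l j (φ w)) u z * g.hat φ u (P j (g.gradHat φ a u)) (g.gradHat φ b u)
      + fderiv ℝ (fderiv ℝ (fun w => a (φ w))) u z (∑ j, l j (φ u) • P j (g.gradHat φ b u))
      + fderiv ℝ (fderiv ℝ (fun w => b (φ w))) u z (∑ j, l j (φ u) • P j (g.gradHat φ a u))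
      - fderiv ℝ (g.hat φ) u z (∑ j, l j (φ u) • P j (g.gradHat φ a u)) (g.gradHat φ b u) := by
  have hφ := h.isParam
  have he : (fun w => T.val (φ w) (diff a (φ w)) (diff b (φ w))) =ᶠ[nhds u]
      fun w => ∑ j, l j (φ w) * g.hat φ w (P j (g.gradHat φ a w)) (g.gradHat φ b w) := by
    filter_upwards [φ.open_source.mem_nhds hu] with w hw
    exact h.val_diff_diff hw ha hb
  have hda := g.differentiableAt_gradHat hφ hu ha
  have hdb := g.differentiableAt_gradHat hφ hu hb
  have hP (j : ι) := (P j).hasFDerivAt.comp u hda.hasFDerivAt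
  have hd (j : ι) := g.hasFDerivAt_hat_apply hφ hu (hP j).differentiableAt hdb z
  have hs := HasFDerivAt.fun_sum (u := Finset.univ) fun j (_ : j ∈ Finset.univ) =>
    (h.differentiableAt_eigenfunction hl hu j).hasFDerivAt.mul (hd j).1.hasFDerivAt
  refine ⟨hs.differentiableAt.congr_of_eventuallyEq he, ?_⟩
  rw [he.fderiv_eq]
  refine (DFunLike.congr_fun hs.fderiv z).trans ?_
  simp only [sum_apply, add_apply, smul_apply, smul_eq_mul, map_sum, map_smul,
    ← Finset.sum_add_distrib, ← Finset.sum_sub_distrib]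
  refine Finset.sum_congr rfl fun j _ => ?_
  rw [(hd j).2, (hP j).fderiv]
  simp only [Function.comp_apply, ContinuousLinearMap.comp_apply]
  rw [h.hat_proj_comm hu j (fderiv ℝ (g.gradHat φ a) u z), g.hat_fderiv_gradHat hφ hu ha,
    g.hat_symm φ u (P j _) (fderiv ℝ (g.gradHat φ b) u z), g.hat_fderiv_gradHat hφ hu hb,
    h.fderiv_hat_proj_comm hu, g.fderiv_hat_symm hφ hu z (g.gradHat φ b u),
    h.fderiv_hat_proj_comm hu]
  ring

/-- Each summand of the bracket is `bracketForm` plus differences such as `Hess b (T∇a, ∇c) - Hess b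
(T∇c, ∇a)`. The opposite difference occurs in another cyclic permutation, so all Hessians cancel in
the sum. -/
theorem Metric.IsAdapted.schouten_eq (h : g.IsAdapted (fun i => T.eigendist g (l i)) φ P)
    (hl : T.IsEigenfunctions g l) (hu : u ∈ φ.source) {a b c : M → ℝ}
    (ha : ContMDiff 𝓘(ℝ, E) 𝓘(ℝ, ℝ) ∞ a) (hb : ContMDiff 𝓘(ℝ, E) 𝓘(ℝ, ℝ) ∞ b)
    (hc : ContMDiff 𝓘(ℝ, E) 𝓘(ℝ, ℝ) ∞ c) :
    schouten (fun q α β => T.val q α β) g.contra a b c (φ u) =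
      (2 / 3 : ℝ) * (
        g.bracketForm φ P l u (g.gradHat φ a u) (g.gradHat φ b u) (g.gradHat φ c u)
        + g.bracketForm φ P l u (g.gradHat φ b u) (g.gradHat φ c u) (g.gradHat φ a u)
        + g.bracketForm φ P l u (g.gradHat φ c u) (g.gradHat φ a u) (g.gradHat φ b u)) := by
  have hφ := h.isParam
  -- Symmetry of the Hessian brings all second derivatives into the antisymmetric form needed for
  -- the cancellation.
  have key {a b c : M → ℝ} (ha : ContMDiff 𝓘(ℝ, E) 𝓘(ℝ, ℝ) ∞ a)
      (hb : ContMDiff 𝓘(ℝ, E) 𝓘(ℝ, ℝ) ∞ b) (hc : ContMDiff 𝓘(ℝ, E) 𝓘(ℝ, ℝ) ∞ c) :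
      T.val (φ u) (diff a (φ u)) (diff (fun q => g.contra q (diff b q) (diff c q)) (φ u))
      - g.contra (φ u) (diff a (φ u)) (diff (fun q => T.val q (diff b q) (diff c q)) (φ u)) =
      g.bracketForm φ P l u (g.gradHat φ a u) (g.gradHat φ b u) (g.gradHat φ c u)
      + (fderiv ℝ (fderiv ℝ (fun w => b (φ w))) u (∑ j, l j (φ u) • P j (g.gradHat φ a u))
          (g.gradHat φ c u)
        - fderiv ℝ (fderiv ℝ (fun w => b (φ w))) u (∑ j, l j (φ u) • P j (g.gradHat φ c u))
          (g.gradHat φ a u))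
      + (fderiv ℝ (fderiv ℝ (fun w => c (φ w))) u (∑ j, l j (φ u) • P j (g.gradHat φ a u))
          (g.gradHat φ b u)
        - fderiv ℝ (fderiv ℝ (fun w => c (φ w))) u (∑ j, l j (φ u) • P j (g.gradHat φ b u))
          (g.gradHat φ a u)) := by
    have h1 (z : V) := h.fderiv_contra_diff_diff hu hb hc z
    have h2 (z : V) := h.fderiv_val_diff_diff hl hu hb hc z
    rw [T.val_diff g, g.contra_diff, g.grad_eq_push hφ hu (hφ.differentiableAt_comp hu ha),
      h.endo_push hu, hφ.diff_push hu (h1 0).1, hφ.diff_push hu (h2 0).1, (h1 _).2, (h2 _).2,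
      hφ.hessian_symm hu hb (g.gradHat φ a u), hφ.hessian_symm hu hc (g.gradHat φ a u),
      Metric.bracketForm]
    ring
  have k1 := key ha hb hc
  have k2 := key hb hc ha
  have k3 := key hc ha hb
  simp only [schouten]
  linear_combination (2 / 3 : ℝ) * (k1 + k2 + k3)

end

/-! ### The conformal Killing equation, block by block. -/

section

variable {E M V : Type*} [NormedAddCommGroup E] [NormedSpace ℝ E] [FiniteDimensional ℝ E]
  [TopologicalSpace M] [ChartedSpace E M] [IsManifold 𝓘(ℝ, E) ∞ M]
  [NormedAddCommGroup V] [NormedSpace ℝ V] [FiniteDimensional ℝ V]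

variable {φ : OpenPartialHomeomorph V M} {u : V} {ι : Type*} [Fintype ι] [DecidableEq ι]
  {g : Metric E M} {T : SymTensor E M} {l : ι → M → ℝ} {P : ι → V →L[ℝ] V}

theorem trilinear_sum_left (B : V →L[ℝ] V →L[ℝ] V →L[ℝ] ℝ) (s : Finset ι) (x : ι → V) (y z : V) :
    B (∑ i ∈ s, x i) y z = ∑ i ∈ s, B (x i) y z :=
  map_sum ((B.flip y).flip z) x s

theorem trilinear_smul_left (B : V →L[ℝ] V →L[ℝ] V →L[ℝ] ℝ) (c : ℝ) (x y z : V) :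
    B (c • x) y z = c * B x y z :=
  map_smul ((B.flip y).flip z) c x

theorem Metric.IsAdapted.sum_smul_proj {D : ι → ∀ p : M, Submodule ℝ (TangentSpace 𝓘(ℝ, E) p)}
    (h : g.IsAdapted D φ P) (c : ι → ℝ) (i : ι) (x : V) :
    ∑ j, c j • P j (P i x) = c i • P i x := by
  rw [Finset.sum_eq_single i (fun j _ hj => by rw [h.proj_proj_of_ne j i hj, smul_zero])
    (by simp), h.proj_proj]

theorem Metric.IsAdapted.bracketForm_proj (h : g.IsAdapted (fun i => T.eigendist g (l i)) φ P)
    (i j : ι) (x y z : V) :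
    g.bracketForm φ P l u (P i x) (P j y) z =
      (l j (φ u) - l i (φ u)) * fderiv ℝ (g.hat φ) u (P i x) (P j y) z
      - fderiv ℝ (fun w => l j (φ w)) u (P i x) * g.hat φ u (P j y) z := by
  rw [Metric.bracketForm, h.sum_smul_proj, h.sum_smul_proj, Finset.sum_eq_single j
    (fun k _ hk => by rw [h.proj_proj_of_ne k j hk, map_zero, zero_apply, mul_zero]) (by simp),
    h.proj_proj, trilinear_smul_left, map_smul, smul_apply, smul_eq_mul]
  ring

/-- Only the first two arguments are decomposed: by block diagonality the second one already selects
the block of `z`. -/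
theorem Metric.IsAdapted.bracketForm_eq_sum (h : g.IsAdapted (fun i => T.eigendist g (l i)) φ P)
    (x y z : V) :
    g.bracketForm φ P l u x y z =
      ∑ i, ∑ j, g.bracketForm φ P l u (P i x) (P j y) z := by
  simp_rw [h.bracketForm_proj, sub_mul, Finset.sum_sub_distrib]
  have h1 : ∑ i, ∑ j, l j (φ u) * fderiv ℝ (g.hat φ) u (P i x) (P j y) z =
      fderiv ℝ (g.hat φ) u x (∑ j, l j (φ u) • P j y) z := by
    conv_rhs => rw [← h.sum_proj x, trilinear_sum_left]
    refine Finset.sum_congr rfl fun i _ => ?_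
    rw [map_sum, sum_apply]
    refine Finset.sum_congr rfl fun j _ => ?_
    rw [map_smul, smul_apply, smul_eq_mul]
  have h2 : ∑ i, ∑ j, l i (φ u) * fderiv ℝ (g.hat φ) u (P i x) (P j y) z =
      fderiv ℝ (g.hat φ) u (∑ j, l j (φ u) • P j x) y z := by
    rw [trilinear_sum_left]
    refine Finset.sum_congr rfl fun i _ => ?_
    conv_rhs => rw [← h.sum_proj y, map_sum, sum_apply]
    exact Finset.sum_congr rfl fun j _ => (trilinear_smul_left _ _ _ _ _).symm
  have h3 : ∑ i, ∑ j, fderiv ℝ (fun w => l j (φ w)) u (P i x) * g.hat φ u (P j y) z =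
      ∑ j, fderiv ℝ (fun w => l j (φ w)) u x * g.hat φ u (P j y) z := by
    conv_rhs => rw [← h.sum_proj x]
    simp only [map_sum, Finset.sum_mul]
    rw [Finset.sum_comm]
  rw [h1, h2, h3, Metric.bracketForm]
  ring

/-- The conformal Killing equation at a point, in an adapted parametrization. -/
def Metric.KillingEq (g : Metric E M) (φ : OpenPartialHomeomorph V M) (P : ι → V →L[ℝ] V)
    (l : ι → M → ℝ) (u t : V) : Prop :=
  ∀ x y z : V, g.bracketForm φ P l u x y z + g.bracketForm φ P l u y z x
      + g.bracketForm φ P l u z x y =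
    -(g.hat φ u t x * g.hat φ u y z + g.hat φ u t y * g.hat φ u z x
      + g.hat φ u t z * g.hat φ u x y)

/-- The derivative of the metric in the directions normal to an eigenspace. -/
def Metric.NormalDerivEq (g : Metric E M) (φ : OpenPartialHomeomorph V M) (P : ι → V →L[ℝ] V)
    (l : ι → M → ℝ) (u : V) : Prop :=
  ∀ i j, i ≠ j → ∀ x y z : V, (l j (φ u) - l i (φ u)) * fderiv ℝ (g.hat φ) u (P i x) (P j y) (P j z) =
    (fderiv ℝ (fun w => l j (φ w)) u (P i x) - fderiv ℝ (fun w => l i (φ w)) u (P i x))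
      * g.hat φ u (P j y) (P j z)

/-- The `(i, i, i)` components involve no derivative of `ĝ` and determine `t`; of the three cyclic
terms in an `(i, j, j)` component only the one with the `E_i` vector first is nonzero. Conversely,
these components already determine `bracketForm` without symmetrization. -/
theorem Metric.IsAdapted.killingEq_iff (h : g.IsAdapted (fun i => T.eigendist g (l i)) φ P)
    (hu : u ∈ φ.source) (t : V) :
    g.KillingEq φ P l u t ↔ g.NormalDerivEq φ P l u ∧
      ∀ i x, fderiv ℝ (fun w => l i (φ w)) u (P i x) = g.hat φ u t (P i x) := by
  constructor
  · intro hK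
    have hdiag (i : ι) (x : V) :
        fderiv ℝ (fun w => l i (φ w)) u (P i x) = g.hat φ u t (P i x) := by
      have hE (x y z : V) := hK (P i x) (P i y) (P i z)
      simp only [h.bracketForm_proj, sub_self, zero_mul, zero_sub] at hE
      -- Let `δ = dλ_i - ĝ(t, ·)` on the `i`-th block. If `δ(x) ≠ 0`, the arguments `(x, x, x)`
      -- force `ĝ(x, x) = 0`, and then `(x, x, y)` forces `ĝ(x, y) = 0` for all `y`, so `x = 0`.
      -- This covers indefinite metrics, where a null `x` cannot be excluded beforehand.
      by_contra hne
      have hne' := sub_ne_zero.2 hne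
      have hsq : g.hat φ u (P i x) (P i x) = 0 := by
        have := hE x x x
        exact (mul_eq_zero.1 (show (fderiv ℝ (fun w => l i (φ w)) u (P i x) -
          g.hat φ u t (P i x)) * g.hat φ u (P i x) (P i x) = 0 by linarith)).resolve_left hne'
      apply hne
      have hx0 : P i x = 0 := by
        refine g.eq_zero_of_hat h.isParam hu fun y => ?_
        have := hE x x y
        rw [hsq, g.hat_symm φ u (P i y) (P i x), ← h.hat_proj_left hu] at this
        exact (mul_eq_zero.1 (show (fderiv ℝ (fun w => l i (φ w)) u (P i x) -
          g.hat φ u t (P i x)) * g.hat φ u (P i x) y = 0 by linarith)).resolve_left hne'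
      rw [hx0, map_zero, map_zero]
    refine ⟨fun i j hij x y z => ?_, hdiag⟩
    have hE := hK (P i x) (P j y) (P j z)
    simp only [h.bracketForm_proj, h.hat_proj_proj hu hij, h.hat_proj_proj hu hij.symm,
      h.fderiv_hat_proj_comm hu i _ x, h.proj_proj_of_ne i j hij, map_zero, sub_self] at hE
    rw [hdiag i x]
    linarith
  · rintro ⟨hN, hD⟩
    -- The identity holds before symmetrization; for `i ≠ j` the `dλ_j` terms cancel and leave
    -- `-dλ_i`, which is `-ĝ(t, ·)` on the `i`-th block.
    have key (x y z : V) : g.bracketForm φ P l u x y z = -(g.hat φ u t x * g.hat φ u y z) := by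
      rw [h.bracketForm_eq_sum]
      conv_rhs => rw [← h.sum_proj x, ← h.sum_proj y]
      rw [map_sum, map_sum, sum_apply, Finset.sum_mul_sum, ← Finset.sum_neg_distrib]
      refine Finset.sum_congr rfl fun i _ => ?_
      rw [← Finset.sum_neg_distrib]
      refine Finset.sum_congr rfl fun j _ => ?_
      rw [h.bracketForm_proj, ← hD i x]
      obtain rfl | hij := eq_or_ne i j
      · ring
      · have := hN i j hij x y z
        rw [← h.hat_proj_left hu, ← h.fderiv_hat_proj_comm hu, h.proj_proj] at this
        rw [this]
        ring
    intro x y z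
    rw [key, key, key]
    ring

/-- Gradients of global smooth functions take every value at the point, so testing on functions is
testing on all triples of vectors. -/
theorem Metric.IsAdapted.conformalKilling_at_iff [T2Space M]
    (h : g.IsAdapted (fun i => T.eigendist g (l i)) φ P) (hl : T.IsEigenfunctions g l)
    (hu : u ∈ φ.source) (t : TangentSpace 𝓘(ℝ, E) (φ u)) (t' : V) (ht : push φ u t' = t) :
    (∀ f₁ f₂ f₃ : M → ℝ, ContMDiff 𝓘(ℝ, E) 𝓘(ℝ, ℝ) ∞ f₁ → ContMDiff 𝓘(ℝ, E) 𝓘(ℝ, ℝ) ∞ f₂ →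
      ContMDiff 𝓘(ℝ, E) 𝓘(ℝ, ℝ) ∞ f₃ →
      schouten (fun q α β => T.val q α β) g.contra f₁ f₂ f₃ (φ u)
        = -2 * symProd t (g.contra (φ u)) (diff f₁ (φ u)) (diff f₂ (φ u)) (diff f₃ (φ u))) ↔
    g.KillingEq φ P l u t' := by
  have hφ := h.isParam
  have hs {a b c : M → ℝ} (ha : ContMDiff 𝓘(ℝ, E) 𝓘(ℝ, ℝ) ∞ a)
      (hb : ContMDiff 𝓘(ℝ, E) 𝓘(ℝ, ℝ) ∞ b) (hc : ContMDiff 𝓘(ℝ, E) 𝓘(ℝ, ℝ) ∞ c) :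
      symProd t (g.contra (φ u)) (diff a (φ u)) (diff b (φ u)) (diff c (φ u)) =
      (1 / 3 : ℝ) * (g.hat φ u t' (g.gradHat φ a u) *
          g.hat φ u (g.gradHat φ b u) (g.gradHat φ c u)
        + g.hat φ u t' (g.gradHat φ b u) * g.hat φ u (g.gradHat φ c u) (g.gradHat φ a u)
        + g.hat φ u t' (g.gradHat φ c u) * g.hat φ u (g.gradHat φ a u) (g.gradHat φ b u)) := by
    rw [symProd, g.contra_diff_diff hφ hu hb hc, g.contra_diff_diff hφ hu hc ha,
      g.contra_diff_diff hφ hu ha hb, ← ht, hφ.diff_push hu (hφ.differentiableAt_comp hu ha),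
      hφ.diff_push hu (hφ.differentiableAt_comp hu hb),
      hφ.diff_push hu (hφ.differentiableAt_comp hu hc), ← g.hat_gradHat hφ hu,
      ← g.hat_gradHat hφ hu, ← g.hat_gradHat hφ hu, g.hat_symm φ u t', g.hat_symm φ u t',
      g.hat_symm φ u t']
  constructor
  · intro hK x y z
    obtain ⟨a, ha, rfl⟩ := g.exists_gradHat_eq hφ hu x
    obtain ⟨b, hb, rfl⟩ := g.exists_gradHat_eq hφ hu y
    obtain ⟨c, hc, rfl⟩ := g.exists_gradHat_eq hφ hu z
    have := hK a b c ha hb hc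
    rw [h.schouten_eq hl hu ha hb hc, hs ha hb hc] at this
    linarith
  · intro hK a b c ha hb hc
    rw [h.schouten_eq hl hu ha hb hc, hs ha hb hc, hK]
    ring

/-! ### Mean curvature normals and the conformal factor. -/

/-- The candidate for the mean curvature normal of the `i`-th eigenspace. -/
def Metric.logNormal (g : Metric E M) (T : SymTensor E M) (l : ι → M → ℝ) (i : ι) (p : M) :
    TangentSpace 𝓘(ℝ, E) p :=
  -(1 / 2 : ℝ) • ∑ j ∈ Finset.univ.erase i,
    g.proj p (T.eigendist g (l j) p) (g.grad (fun q => Real.log |l i q - l j q|) p)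

theorem Metric.IsAdapted.hasFDerivAt_log
    (h : g.IsAdapted (fun i => T.eigendist g (l i)) φ P) (hl : T.IsEigenfunctions g l)
    (hu : u ∈ φ.source) {i j : ι} (hij : i ≠ j) :
    HasFDerivAt (fun w => Real.log |l i (φ w) - l j (φ w)|)
      ((l i (φ u) - l j (φ u))⁻¹ •
        (fderiv ℝ (fun w => l i (φ w)) u - fderiv ℝ (fun w => l j (φ w)) u)) u := by
  simp_rw [Real.log_abs]
  exact ((h.differentiableAt_eigenfunction hl hu i).hasFDerivAt.sub
    (h.differentiableAt_eigenfunction hl hu j).hasFDerivAt).log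
    (sub_ne_zero.2 fun he => hij (hl.distinct (φ u) he))

theorem Metric.IsAdapted.val_logNormal
    (h : g.IsAdapted (fun i => T.eigendist g (l i)) φ P) (hl : T.IsEigenfunctions g l)
    (hu : u ∈ φ.source) (i : ι) (v : V) :
    g.val (φ u) (g.logNormal T l i (φ u)) (push φ u v) =
      -(1 / 2 : ℝ) * ∑ j ∈ Finset.univ.erase i, (l i (φ u) - l j (φ u))⁻¹ *
        (fderiv ℝ (fun w => l i (φ w)) u (P j v) - fderiv ℝ (fun w => l j (φ w)) u (P j v)) := by
  rw [Metric.logNormal, map_smul, smul_apply, smul_eq_mul, map_sum, sum_apply]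
  congr 1
  refine Finset.sum_congr rfl fun j hj => ?_
  have hd := h.hasFDerivAt_log hl hu (Finset.ne_of_mem_erase hj).symm
  rw [g.grad_eq_push h.isParam hu hd.differentiableAt, h.proj_push hu j, ← g.hat_apply,
    h.hat_proj_comm hu, g.hat_gradHat h.isParam hu, hd.fderiv]
  rfl

/-- The right-hand condition is umbilicity with normal `logNormal`, in the form given by `val_sff`.
A normal vector is the sum of its components in the other blocks, and each component contributes one
logarithmic derivative; distinct eigenvalues allow the division. -/
theorem Metric.IsAdapted.normalDerivEq_iff
    (h : g.IsAdapted (fun i => T.eigendist g (l i)) φ P) (hl : T.IsEigenfunctions g l)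
    (hu : u ∈ φ.source) :
    g.NormalDerivEq φ P l u ↔ ∀ i x y, P i x = x → P i y = y → ∀ v,
      -(1 / 2 : ℝ) * fderiv ℝ (g.hat φ) u (v - P i v) x y =
        g.hat φ u x y * g.val (φ u) (g.logNormal T l i (φ u)) (push φ u v) := by
  have hne {i j : ι} (hij : i ≠ j) : l i (φ u) - l j (φ u) ≠ 0 :=
    sub_ne_zero.2 fun he => hij (hl.distinct (φ u) he)
  constructor
  · intro hN i x y hx hy v
    have hv : v - P i v = ∑ j ∈ Finset.univ.erase i, P j v := by
      rw [sub_eq_iff_eq_add, Finset.sum_erase_add _ _ (Finset.mem_univ i), h.sum_proj]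
    rw [h.val_logNormal hl hu, hv, trilinear_sum_left]
    simp only [Finset.mul_sum]
    refine Finset.sum_congr rfl fun j hj => ?_
    have hji := Finset.ne_of_mem_erase hj
    have := hN j i hji v x y
    rw [hx, hy] at this
    have hne' := hne hji.symm
    field_simp
    linear_combination -this
  · intro hN i j hij x y z
    -- Testing on a vector of a single block `i ≠ j` isolates one summand of the normal.
    have := hN j (P j y) (P j z) (h.proj_proj _ _) (h.proj_proj _ _) (P i x)
    rw [h.val_logNormal hl hu, h.proj_proj_of_ne j i hij.symm, sub_zero,
      Finset.sum_eq_single i (fun k _ hk => by rw [h.proj_proj_of_ne k i hk]; simp)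
        (fun hi => absurd (Finset.mem_erase.2 ⟨hij, Finset.mem_univ i⟩) hi), h.proj_proj] at this
    have hne' := hne hij.symm
    field_simp at this
    linear_combination -this

theorem Metric.IsAdapted.factor_eq_iff
    (h : g.IsAdapted (fun i => T.eigendist g (l i)) φ P) (hl : T.IsEigenfunctions g l)
    (hu : u ∈ φ.source) (t' : V) :
    (∀ i x, fderiv ℝ (fun w => l i (φ w)) u (P i x) = g.hat φ u t' (P i x)) ↔
    push φ u t' = ∑ i, g.proj (φ u) (T.eigendist g (l i) (φ u)) (g.grad (l i) (φ u)) := by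
  have hφ := h.isParam
  have hs : ∑ i, g.proj (φ u) (T.eigendist g (l i) (φ u)) (g.grad (l i) (φ u)) =
      push φ u (∑ i, P i (g.gradHat φ (l i) u)) := by
    rw [map_sum]
    refine Finset.sum_congr rfl fun i _ => ?_
    rw [g.grad_eq_push hφ hu (h.differentiableAt_eigenfunction hl hu i), h.proj_push hu i]
  have hv (v : V) : g.hat φ u (∑ i, P i (g.gradHat φ (l i) u)) v =
      ∑ i, fderiv ℝ (fun w => l i (φ w)) u (P i v) := by
    rw [map_sum, sum_apply]
    refine Finset.sum_congr rfl fun i _ => ?_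
    rw [h.hat_proj_comm hu, g.hat_gradHat hφ hu]
  rw [hs, (hφ.push_injective hu).eq_iff]
  constructor
  · intro hD
    rw [← sub_eq_zero]
    refine g.eq_zero_of_hat hφ hu fun v => ?_
    rw [map_sub, sub_apply, hv]
    conv_lhs => enter [1]; rw [← h.sum_proj v, map_sum]
    rw [sub_eq_zero]
    exact Finset.sum_congr rfl fun i _ => (hD i v).symm
  · rintro rfl i x
    rw [hv, Finset.sum_eq_single i (fun j _ hj => by rw [h.proj_proj_of_ne j i hj, map_zero])
      (by simp), h.proj_proj]

theorem Metric.IsAdapted.sff_eq_of_normalDerivEq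
    (h : g.IsAdapted (fun i => T.eigendist g (l i)) φ P) (hl : T.IsEigenfunctions g l)
    (hu : u ∈ φ.source) (hN : g.NormalDerivEq φ P l u) (i : ι)
    {X Y : ∀ p : M, TangentSpace 𝓘(ℝ, E) p} (hX : IsSmoothField X) (hY : IsSmoothField Y)
    (hXD : ∀ p, X p ∈ T.eigendist g (l i) p) (hYD : ∀ p, Y p ∈ T.eigendist g (l i) p) :
    g.sff (T.eigendist g (l i)) X Y (φ u) =
      g.val (φ u) (X (φ u)) (Y (φ u)) • g.logNormal T l i (φ u) := by
  have hφ := h.isParam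
  have hP {X : ∀ p : M, TangentSpace 𝓘(ℝ, E) p} (hXD : ∀ p, X p ∈ T.eigendist g (l i) p)
      {w : V} (hw : w ∈ φ.source) : P i (pull φ X w) = pull φ X w :=
    (h.mem_iff w hw i _).1 (by rw [hφ.push_pull hw]; exact hXD _)
  rw [← sub_eq_zero]
  refine g.nondegenerate _ _ fun v => ?_
  obtain ⟨v, rfl⟩ := hφ.push_surjective hu v
  rw [map_sub, sub_apply, h.val_sff hu i hX.contMDiffAt hY.contMDiffAt (hP hXD hu)
    (Filter.eventually_of_mem (φ.open_source.mem_nhds hu) fun w hw => hP hYD hw),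
    (h.normalDerivEq_iff hl hu).1 hN i _ _ (hP hXD hu) (hP hYD hu), map_smul, smul_apply,
    smul_eq_mul, g.hat_pull hφ hu, sub_self]

/-- The symmetrized form is `g` times `logNormal`, so the trace returns `logNormal`; the eigenspace
is nonzero because `l i` is an eigenvalue. -/
theorem Metric.IsAdapted.meanCurvatureNormal_eq_of_normalDerivEq
    (h : g.IsAdapted (fun i => T.eigendist g (l i)) φ P) (hl : T.IsEigenfunctions g l)
    (hnet : g.IsIntegrableNet fun i => T.eigendist g (l i))
    (hu : u ∈ φ.source) (hN : g.NormalDerivEq φ P l u) (i : ι) :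
    g.meanCurvatureNormal (T.eigendist g (l i)) (φ u) = g.logNormal T l i (φ u) := by
  have hφ := h.isParam
  refine g.meanCurvatureNormal_eq _ _ _ ((hl.hasEigenvalue_iff (φ u) (l i (φ u))).2 ⟨i, rfl⟩)
    (hnet.nondegenerate i (φ u)) fun x hx y hy => ?_
  obtain ⟨x, rfl⟩ := hφ.push_surjective hu x
  obtain ⟨y, rfl⟩ := hφ.push_surjective hu y
  have hx' := (h.mem_iff u hu i x).1 hx
  have hy' := (h.mem_iff u hu i y).1 hy
  rw [← sub_eq_zero]
  refine g.nondegenerate _ _ fun v => ?_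
  obtain ⟨v, rfl⟩ := hφ.push_surjective hu v
  rw [map_sub, sub_apply, h.val_symmSff hu i hx' hy', (h.normalDerivEq_iff hl hu).1 hN i _ _ hx' hy',
    map_smul, smul_apply, smul_eq_mul, g.hat_apply, sub_self]

/-- Umbilicity speaks of global sections, so the given vectors are first extended by
`exists_section`. -/
theorem Metric.IsAdapted.normalDerivEq_of_isUmbilical [T2Space M]
    (h : g.IsAdapted (fun i => T.eigendist g (l i)) φ P) (hl : T.IsEigenfunctions g l)
    (hu : u ∈ φ.source) (hU : ∀ i, g.IsUmbilical (T.eigendist g (l i)))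
    (hH : ∀ i, g.meanCurvatureNormal (T.eigendist g (l i)) (φ u) = g.logNormal T l i (φ u)) :
    g.NormalDerivEq φ P l u := by
  have hφ := h.isParam
  rw [h.normalDerivEq_iff hl hu]
  intro i x y hx hy v
  obtain ⟨X, hX, hXD, rfl⟩ := h.exists_section hu i hx
  obtain ⟨Y, hY, hYD, rfl⟩ := h.exists_section hu i hy
  have hYP : ∀ᶠ w in nhds u, P i (pull φ Y w) = pull φ Y w :=
    Filter.eventually_of_mem (φ.open_source.mem_nhds hu) fun w hw =>
      (h.mem_iff w hw i _).1 (by rw [hφ.push_pull hw]; exact hYD _)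
  rw [← h.val_sff hu i hX.contMDiffAt hY.contMDiffAt hx hYP, hU i X Y hX hY hXD hYD, hH,
    map_smul, smul_apply, smul_eq_mul, g.hat_pull hφ hu]

end

end PseudoRiem

end

/-! ### The characterization of conformal Killing tensors. -/

theorem mainTheorem5 {E M : Type*} [NormedAddCommGroup E] [NormedSpace ℝ E]
    [FiniteDimensional ℝ E] [TopologicalSpace M] [T2Space M] [ChartedSpace E M]
    [IsManifold 𝓘(ℝ, E) ∞ M] (g : PseudoRiem.Metric E M) (T : PseudoRiem.SymTensor E M)
    (hT : T.IsOrthogonal g) {ι : Type*} [Fintype ι] [DecidableEq ι] (l : ι → M → ℝ)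
    (hl : T.IsEigenfunctions g l) (hnet : g.IsIntegrableNet fun i => T.eigendist g (l i))
    (t : ∀ p : M, TangentSpace 𝓘(ℝ, E) p) (ht : PseudoRiem.IsSmoothField t) :
    T.IsConformalKilling g t ↔
      (∀ i, g.IsUmbilical (T.eigendist g (l i))) ∧
      (∀ i p, g.meanCurvatureNormal (T.eigendist g (l i)) p =
        -(1 / 2 : ℝ) • ∑ j ∈ Finset.univ.erase i,
          g.proj p (T.eigendist g (l j) p) (g.grad (fun q => Real.log |l i q - l j q|) p)) ∧
      (∀ p, t p = ∑ i, g.proj p (T.eigendist g (l i) p) (g.grad (l i) p)) := by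
  constructor
  · intro hK
    -- All three conditions are pointwise in `p`, so one adapted parametrization around `p` yields
    -- them together.
    have key (p : M) :
        (∀ i (X Y : ∀ p : M, TangentSpace 𝓘(ℝ, E) p), PseudoRiem.IsSmoothField X →
          PseudoRiem.IsSmoothField Y → (∀ p, X p ∈ T.eigendist g (l i) p) →
          (∀ p, Y p ∈ T.eigendist g (l i) p) → g.sff (T.eigendist g (l i)) X Y p =
            g.val p (X p) (Y p) • g.meanCurvatureNormal (T.eigendist g (l i)) p) ∧
        (∀ i, g.meanCurvatureNormal (T.eigendist g (l i)) p = g.logNormal T l i p) ∧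
        t p = ∑ i, g.proj p (T.eigendist g (l i) p) (g.grad (l i) p) := by
      obtain ⟨m, φ, P, h, hp⟩ := hnet.exists_isAdapted p
      obtain ⟨u, hu, rfl⟩ : ∃ u ∈ φ.source, φ u = p :=
        ⟨φ.symm p, φ.map_target hp, φ.right_inv hp⟩
      obtain ⟨t', ht'⟩ := h.isParam.push_surjective hu (t (φ u))
      have h1 := (h.conformalKilling_at_iff hl hu _ t' ht').1
        fun a b c ha hb hc => hK a b c ha hb hc (φ u)
      obtain ⟨hN, hD⟩ := (h.killingEq_iff hu t').1 h1
      exact And.intro (fun i X Y hX hY hXD hYD =>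
        (h.sff_eq_of_normalDerivEq hl hu hN i (X := X) (Y := Y) hX hY hXD hYD).trans
          (congrArg _ (h.meanCurvatureNormal_eq_of_normalDerivEq hl hnet hu hN i).symm))
        (And.intro (fun i => h.meanCurvatureNormal_eq_of_normalDerivEq hl hnet hu hN i)
        (ht'.symm.trans ((h.factor_eq_iff hl hu t').1 hD)))
    exact ⟨fun i X Y hX hY hXD hYD p => (key p).1 i X Y hX hY hXD hYD,
      fun i p => (key p).2.1 i, fun p => (key p).2.2⟩
  · rintro ⟨hU, hH, hF⟩ a b c ha hb hc p
    obtain ⟨m, φ, P, h, hp⟩ := hnet.exists_isAdapted p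
    obtain ⟨u, hu, rfl⟩ : ∃ u ∈ φ.source, φ u = p :=
      ⟨φ.symm p, φ.map_target hp, φ.right_inv hp⟩
    obtain ⟨t', ht'⟩ := h.isParam.push_surjective hu (t (φ u))
    exact (h.conformalKilling_at_iff hl hu _ t' ht').2 ((h.killingEq_iff hu t').2
      ⟨h.normalDerivEq_of_isUmbilical hl hu hU fun i => hH i (φ u),
        (h.factor_eq_iff hl hu t').2 (ht'.trans (hF (φ u)))⟩) a b c ha hb hc
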